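/- Let $k$ be a commutative ring. For a $k$-linear category $\mathfrak{a}$, a sieve on an object $A$ is a $k$-submodule $R\subseteq\mathfrak{a}(-,A)$; a (linear) topology assigns to each $A$ a collection of covering sieves on $A$ such that $\mathfrak{a}(-,A)$ is covering, pullbacks of covering sieves are covering, and a sieve $S$ on $A$ is covering whenever there is a covering sieve $R$ on $A$ with $f^{-1}S$ covering for all $f\in R$. $\mathsf{Sh}(\mathfrak{a},\mathcal{T})$ is the category of $k$-linear functors $F:\mathfrak{a}^{\mathrm{op}}\to\mathsf{Mod}(k)$ for which $F(A)\to\mathrm{Hom}(R,F)$ is bijective for all $R\in\mathcal{T}(A)$. For $k$-linear $\phi:\mathfrak{a}\to\mathfrak{c}$, $\phi R$ is the sieve generated by all $\phi(f)$, $f\in R$, and $\phi^{-1}\mathcal{T}=\{R\mid \phi R\in\mathcal{T}\}$. A functor $\phi:(\mathfrak{a},\mathcal{T}_{\mathfrak{a}})\to(\mathfrak{c},\mathcal{T}_{\mathfrak{c}})$ satisfies (LC) if: (G) every object $C$ of $\mathfrak{c}$ has a family $(\phi(A_i)\to C)_i$ that generates a covering sieve; (F) for every $c:\phi(A)\to\phi(A')$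 there are a family $(a_i:A_i\to A)_i$ generating a covering sieve and $f_i:A_i\to A'$ with $c\,\phi(a_i)=\phi(f_i)$; (FF) for every $a:A\to A'$ with $\phi(a)=0$ there is a family $(a_i:A_i\to A)_i$ generating a covering sieve with $a a_i=0$; and $\mathcal{T}_{\mathfrak{a}}=\phi^{-1}\mathcal{T}_{\mathfrak{c}}$. The category $\mathfrak{a}\otimes\mathfrak{b}$ has pairs of objects as objects and $(\mathfrak{a}\otimes\mathfrak{b})((A,B),(A',B'))=\mathfrak{a}(A,A')\otimes_k\mathfrak{b}(B,B')$. For sieves $R$ on $A$ and $S$ on $B$, $R\boxtimes S$ is the image of $R\otimes S$ in $(\mathfrak{a}\otimes\mathfrak{b})(-,(A,B))$, and $\mathcal{T}_{\mathfrak{a}}\boxtimes\mathcal{T}_{\mathfrak{b}}$ is the smallest topology on $\mathfrak{a}\otimes\mathfrak{b}$ containing all $R\boxtimes\mathfrak{b}(-,B)$ with $R\in\mathcal{T}_{\mathfrak{a}}$ and all $\mathfrak{a}(-,A)\boxtimes S$ with $S\in\mathcal{T}_{\mathfrak{b}}$. For $k$-linear Grothendieck categories $\mathcal{C},\mathcal{D}$,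 the category $\mathcal{C}\boxtimes\mathcal{D}$ is defined up to ($k$-linear) equivalence by $\mathcal{C}\boxtimes\mathcal{D}\cong\mathsf{Sh}(\mathfrak{a}'\otimes\mathfrak{b}',\mathcal{T}_{\mathfrak{a}'}\boxtimes\mathcal{T}_{\mathfrak{b}'})$ for arbitrary small linear sites with $k$-linear functors $(\mathfrak{a}',\mathcal{T}_{\mathfrak{a}'})\to\mathcal{C}$, $(\mathfrak{b}',\mathcal{T}_{\mathfrak{b}'})\to\mathcal{D}$ that satisfy (LC) with respect to the topologies of jointly epimorphic sieves on $\mathcal{C}$ and $\mathcal{D}$ (such functors exist, and the choice does not matter). A (positively graded) $\mathbb{Z}$-algebra is a $k$-linear category $\mathfrak{a}$ with $\mathrm{Ob}(\mathfrak{a})=\mathbb{Z}$ and $\mathfrak{a}(n,m)=0$ for $n<m$. It is generated in degree $1$ if every morphism is a $k$-linear combination of composites (identities included) of elements of the modules $\mathfrak{a}(n+1,n)$. Let $\mathfrak{a}(l,m)_{\geq n}=\mathfrak{a}(l,m)$ if $l\geq n$, and $0$ otherwise. The tails topology of $\mathfrak{a}$ is the closure under enlarging sieves and glueing (equivalently,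 the smallest topology containing it) of the system of all sieves on $m$ that contain $\mathfrak{a}(-,m)_{\geq n}$ for some $n\geq m$, $m\in\mathbb{Z}$. **Theorem.** Let $\mathfrak{a}$ and $\mathfrak{b}$ be positively graded $\mathbb{Z}$-algebras over $k$ which are generated in degree $1$, and let $\mathfrak{c}=(\mathfrak{a}\otimes\mathfrak{b})_\Delta$ be the diagonal $\mathbb{Z}$-algebra, $\mathfrak{c}(n,m)=\mathfrak{a}(n,m)\otimes_k\mathfrak{b}(n,m)$, with the fully faithful functor $\Delta:\mathfrak{c}\to\mathfrak{a}\otimes\mathfrak{b}$, $n\mapsto(n,n)$. Let $\mathcal{T}_{\mathfrak{a}},\mathcal{T}_{\mathfrak{b}},\mathcal{T}_{\mathfrak{c}}$ be the tails topologies. Then $\Delta:(\mathfrak{c},\mathcal{T}_{\mathfrak{c}})\to(\mathfrak{a}\otimes\mathfrak{b},\mathcal{T}_{\mathfrak{a}}\boxtimes\mathcal{T}_{\mathfrak{b}})$ satisfies (LC). In particular, $\mathcal{T}_{\mathfrak{c}}=\Delta^{-1}(\mathcal{T}_{\mathfrak{a}}\boxtimes\mathcal{T}_{\mathfrak{b}})$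 and $$\mathsf{Sh}(\mathfrak{a},\mathcal{T}_{\mathfrak{a}})\boxtimes\mathsf{Sh}(\mathfrak{b},\mathcal{T}_{\mathfrak{b}})=\mathsf{Sh}(\mathfrak{a}\otimes\mathfrak{b},\mathcal{T}_{\mathfrak{a}}\boxtimes\mathcal{T}_{\mathfrak{b}})\cong\mathsf{Sh}(\mathfrak{c},\mathcal{T}_{\mathfrak{c}}).$$ -/

import Mathlib

open CategoryTheory Opposite TensorProduct

universe u v v₁ v₂ w w₁ w₂

noncomputable section

/-! ### Linear sieves, cover systems and linear topologies -/

section Sieves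

/-- A linear sieve on an object `A` of a `k`-linear category: a `k`-submodule of the representable
module `C(-, A)`, that is, a `k`-submodule of `C(B, A)` for every `B`, stable under
precomposition. -/
@[ext]
structure LinSieve (k : Type u) [CommRing k] {C : Type w} [Category.{v} C] [Preadditive C]
    [Linear k C] (A : C) where
  arrows : ∀ B : C, Submodule k (B ⟶ A)
  comp_mem : ∀ {B B' : C} (g : B' ⟶ B) {f : B ⟶ A}, f ∈ arrows B → g ≫ f ∈ arrows B'

namespace LinSieve

variable {k : Type u} [CommRing k] {C : Type w} [Category.{v} C] [Preadditive C] [Linear k C]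

/-- Inclusion of sieves. -/
instance (A : C) : LE (LinSieve k A) where
  le R S := ∀ B, R.arrows B ≤ S.arrows B

/-- The full sieve `C(-, A)`. -/
instance (A : C) : Top (LinSieve k A) where
  top := { arrows := fun _ => ⊤, comp_mem := fun _ _ _ => Submodule.mem_top }

/-- The pullback `h⁻¹ R` of a sieve along `h : A' ⟶ A`. -/
def pullback {A A' : C} (R : LinSieve k A) (h : A' ⟶ A) : LinSieve k A' where
  arrows B := (R.arrows B).comap (Linear.rightComp k B h)
  comp_mem g f hf := by
    simp only [Submodule.mem_comap, Linear.rightComp_apply, Category.assoc] at hf ⊢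
    exact R.comp_mem g hf

variable (k) in
/-- The sieve `⟨fᵢ⟩` generated by a family of morphisms `fᵢ : X i ⟶ A`. -/
def ofFamily {A : C} {ι : Type*} (X : ι → C) (f : ∀ i, X i ⟶ A) : LinSieve k A where
  arrows B := Submodule.span k {h | ∃ (i : ι) (g : B ⟶ X i), h = g ≫ f i}
  comp_mem {B B'} g h hh := by
    have key : Submodule.span k {h : B ⟶ A | ∃ (i : ι) (g : B ⟶ X i), h = g ≫ f i} ≤
        (Submodule.span k {h : B' ⟶ A | ∃ (i : ι) (g : B' ⟶ X i), h = g ≫ f i}).comap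
          (Linear.leftComp k A g) := by
      refine Submodule.span_le.2 ?_
      rintro _ ⟨i, g', rfl⟩
      exact Submodule.subset_span ⟨i, g ≫ g', by simp⟩
    exact key hh

/-- The image `φ R`: the sieve on `φ A` generated by all `φ f` with `f` in `R`. -/
def map {D : Type w₁} [Category.{v₁} D] [Preadditive D] [Linear k D] (φ : C ⥤ D) {A : C}
    (R : LinSieve k A) : LinSieve k (φ.obj A) :=
  ofFamily k (ι := Σ B : C, R.arrows B) (fun i => φ.obj i.1) (fun i => φ.map i.2.1)

end LinSieve

/-- A cover system: for every object, a collection of (covering) sieves on it. -/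
abbrev CoverSystem (k : Type u) [CommRing k] (C : Type w) [Category.{v} C] [Preadditive C]
    [Linear k C] : Type _ :=
  ∀ A : C, Set (LinSieve k A)

namespace CoverSystem

variable {k : Type u} [CommRing k] {C : Type w} [Category.{v} C] [Preadditive C] [Linear k C]

/-- A linear topology: a cover system with the identity, pullback and glueing axioms. -/
structure IsTopology (T : CoverSystem k C) : Prop where
  identity : ∀ A : C, ⊤ ∈ T A
  pullback : ∀ {A A' : C} (h : A' ⟶ A) {R : LinSieve k A}, R ∈ T A → R.pullback h ∈ T A'
  glueing : ∀ {A : C} {R : LinSieve k A} (S : LinSieve k A), R ∈ T A →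
    (∀ (B : C) (f : B ⟶ A), f ∈ R.arrows B → S.pullback f ∈ T B) → S ∈ T A

/-- The smallest topology containing a cover system. -/
def topGen (𝓡 : CoverSystem k C) : CoverSystem k C :=
  fun A => {S | ∀ T : CoverSystem k C, T.IsTopology → (∀ B, 𝓡 B ⊆ T B) → S ∈ T A}

/-- The closure of a cover system under enlarging and glueing, as a predicate on sieves. -/
inductive UpGlue (𝓡 : CoverSystem k C) : ∀ {A : C}, LinSieve k A → Prop
  | of {A : C} {R : LinSieve k A} : R ∈ 𝓡 A → UpGlue 𝓡 R
  | up {A : C} {R S : LinSieve k A} : UpGlue 𝓡 R → R ≤ S → UpGlue 𝓡 S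
  | glue {A : C} {R S : LinSieve k A} : UpGlue 𝓡 R →
      (∀ (B : C) (f : B ⟶ A), f ∈ R.arrows B → UpGlue 𝓡 (S.pullback f)) → UpGlue 𝓡 S

/-- The cover system `𝓡^upglue`. -/
def upglue (𝓡 : CoverSystem k C) : CoverSystem k C :=
  fun _ => {R | UpGlue 𝓡 R}

/-- The inverse image `φ⁻¹ T = {R | φ R ∈ T}`. -/
def inverseImage {D : Type w₁} [Category.{v₁} D] [Preadditive D] [Linear k D] (φ : C ⥤ D)
    (T : CoverSystem k D) : CoverSystem k C :=
  fun A => {R | R.map φ ∈ T (φ.obj A)}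

variable (k C) in
/-- The cover system of jointly epimorphic sieves (the canonical topology, if `C` is a
Grothendieck category). -/
def jointlyEpi : CoverSystem k C :=
  fun A => {R | ∀ (D : C) (g : A ⟶ D), (∀ (B : C), ∀ f ∈ R.arrows B, f ≫ g = 0) → g = 0}

end CoverSystem

/-! ### Condition (LC) -/

section LC

variable {k : Type u} [CommRing k]
  {A : Type w₁} [Category.{v₁} A] [Preadditive A] [Linear k A]
  {C : Type w₂} [Category.{v₂} C] [Preadditive C] [Linear k C]

/-- Condition (G): every object of `C` has a covering family by objects in the image of `φ`. -/
def SatisfiesG (φ : A ⥤ C) (TC : CoverSystem k C) : Prop :=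
  ∀ X : C, ∃ (ι : Type (max w₁ v₂)) (a : ι → A) (f : ∀ i, φ.obj (a i) ⟶ X),
    LinSieve.ofFamily k (fun i => φ.obj (a i)) f ∈ TC X

/-- Condition (F): `φ` is full up to coverings. -/
def SatisfiesF (TA : CoverSystem k A) (φ : A ⥤ C) : Prop :=
  ∀ (X X' : A) (c : φ.obj X ⟶ φ.obj X'),
    ∃ (ι : Type (max w₁ v₁)) (Y : ι → A) (a : ∀ i, Y i ⟶ X) (f : ∀ i, Y i ⟶ X'),
      LinSieve.ofFamily k Y a ∈ TA X ∧ ∀ i, φ.map (a i) ≫ c = φ.map (f i)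

/-- Condition (FF): `φ` is faithful up to coverings. -/
def SatisfiesFF (TA : CoverSystem k A) (φ : A ⥤ C) : Prop :=
  ∀ (X X' : A) (b : X ⟶ X'), φ.map b = 0 →
    ∃ (ι : Type (max w₁ v₁)) (Y : ι → A) (a : ∀ i, Y i ⟶ X),
      LinSieve.ofFamily k Y a ∈ TA X ∧ ∀ i, a i ≫ b = 0

/-- Condition (LC) for a functor between categories with cover systems. -/
structure SatisfiesLC (TA : CoverSystem k A) (φ : A ⥤ C) (TC : CoverSystem k C) : Prop where
  generating : SatisfiesG φ TC
  full : SatisfiesF TA φ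
  faithful : SatisfiesFF TA φ
  topology_eq : TA = TC.inverseImage φ

end LC

end Sieves

/-! ### Modules and sheaves -/

section Sheaves

variable {k : Type u} [CommRing k] {C : Type w} [Category.{u} C] [Preadditive C] [Linear k C]

/-- The sheaf condition for `F` and a sieve `R` on `A`: the map `F(A) → Hom(R, F)` into the module
morphisms from `R` to `F` is bijective. -/
def IsSheafForSieve (F : Cᵒᵖ ⥤ ModuleCat.{u} k) {A : C} (R : LinSieve k A) : Prop :=
  ∀ x : ∀ B : C, R.arrows B →ₗ[k] F.obj (op B),
    (∀ (B B' : C) (g : B' ⟶ B) (f : R.arrows B),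
      x B' ⟨g ≫ f.1, R.comp_mem g f.2⟩ = F.map g.op (x B f)) →
    ∃! y : F.obj (op A), ∀ (B : C) (f : R.arrows B), F.map f.1.op y = x B f

/-- `F` is a `C`-module (a `k`-linear functor `Cᵒᵖ ⥤ Mod k`) and a sheaf for `T`. -/
structure IsLinearSheaf (T : CoverSystem k C) (F : Cᵒᵖ ⥤ ModuleCat.{u} k) : Prop where
  map_add : ∀ {X Y : C} (f g : X ⟶ Y), F.map (f + g).op = F.map f.op + F.map g.op
  map_smul : ∀ {X Y : C} (r : k) (f : X ⟶ Y), F.map (r • f).op = r • F.map f.op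
  isSheaf : ∀ (A : C), ∀ R ∈ T A, IsSheafForSieve F R

/-- The `k`-linear category `Sh(C, T)`, a full subcategory of the functor category. -/
abbrev Sh (T : CoverSystem k C) : Type _ :=
  ObjectProperty.FullSubcategory (C := Cᵒᵖ ⥤ ModuleCat.{u} k) (IsLinearSheaf T)

end Sheaves

/-- Equivalence of `k`-linear categories. -/
def LinearEquivalent (k : Type u) [CommRing k]
    (C : Type w₁) [Category.{v₁} C] [Preadditive C] [Linear k C]
    (D : Type w₂) [Category.{v₂} D] [Preadditive D] [Linear k D] : Prop :=
  ∃ e : C ≌ D, e.functor.Additive ∧ e.functor.Linear k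

/-! ### Tensor products of linear categories and of linear sites -/

section TensorProducts

/-- The tensor product `A ⊗ₖ B` of `k`-linear categories: objects are pairs of objects, and
morphism modules are tensor products of morphism modules. -/
structure TensorCat (k : Type u) (A : Type w₁) (B : Type w₂) where
  fst : A
  snd : B

variable {k : Type u} [CommRing k]
  {A : Type w₁} [Category.{v₁} A] [Preadditive A] [Linear k A]
  {B : Type w₂} [Category.{v₂} B] [Preadditive B] [Linear k B]

namespace TensorCat

/-- Composition of `A ⊗ₖ B`, determined by `(f ⊗ g) ≫ (f' ⊗ g') = (f ≫ f') ⊗ (g ≫ g')`. -/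
def compₗ (X Y Z : TensorCat k A B) :
    ((X.fst ⟶ Y.fst) ⊗[k] (X.snd ⟶ Y.snd)) →ₗ[k] ((Y.fst ⟶ Z.fst) ⊗[k] (Y.snd ⟶ Z.snd)) →ₗ[k]
      ((X.fst ⟶ Z.fst) ⊗[k] (X.snd ⟶ Z.snd)) :=
  TensorProduct.map₂ (Linear.comp X.fst Y.fst Z.fst) (Linear.comp X.snd Y.snd Z.snd)

instance : Category (TensorCat k A B) where
  Hom X Y := (X.fst ⟶ Y.fst) ⊗[k] (X.snd ⟶ Y.snd)
  id X := 𝟙 X.fst ⊗ₜ 𝟙 X.snd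
  comp {X Y Z} f g := compₗ X Y Z f g
  id_comp {X Y} f := by
    induction f using TensorProduct.induction_on with
    | zero => simp
    | tmul a b => simp [compₗ]
    | add x y hx hy => rw [map_add, hx, hy]
  comp_id {X Y} f := by
    induction f using TensorProduct.induction_on with
    | zero => simp
    | tmul a b => simp [compₗ]
    | add x y hx hy => rw [map_add, LinearMap.add_apply, hx, hy]
  assoc {W X Y Z} f g h := by
    induction f using TensorProduct.induction_on with
    | zero => simp
    | add x y hx hy => simp only [map_add, LinearMap.add_apply, hx, hy]
    | tmul a b =>
      induction g using TensorProduct.induction_on with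
      | zero => simp
      | add x y hx hy => simp only [map_add, LinearMap.add_apply, hx, hy]
      | tmul a' b' =>
        induction h using TensorProduct.induction_on with
        | zero => simp
        | add x y hx hy => simp only [map_add, hx, hy]
        | tmul a'' b'' => simp [compₗ]

instance : Preadditive (TensorCat k A B) where
  homGroup X Y := inferInstanceAs (AddCommGroup ((X.fst ⟶ Y.fst) ⊗[k] (X.snd ⟶ Y.snd)))
  add_comp X Y Z f f' g := LinearMap.map_add₂ (compₗ X Y Z) f f' g
  comp_add X Y Z f g g' := LinearMap.map_add (compₗ X Y Z f) g g'

instance : Linear k (TensorCat k A B) where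
  homModule X Y := inferInstanceAs (Module k ((X.fst ⟶ Y.fst) ⊗[k] (X.snd ⟶ Y.snd)))
  smul_comp X Y Z r f g := LinearMap.map_smul₂ (compₗ X Y Z) r f g
  comp_smul X Y Z f r g := LinearMap.map_smul (compₗ X Y Z f) r g

/-- The morphism `f ⊗ g` of `A ⊗ₖ B`. -/
def homMk {X Y : TensorCat k A B} (f : X.fst ⟶ Y.fst) (g : X.snd ⟶ Y.snd) : X ⟶ Y :=
  f ⊗ₜ[k] g

/-- `(f, g) ↦ f ⊗ g` as a bilinear map. -/
def homMkₗ (X Y : TensorCat k A B) :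
    (X.fst ⟶ Y.fst) →ₗ[k] (X.snd ⟶ Y.snd) →ₗ[k] (X ⟶ Y) :=
  TensorProduct.mk k (X.fst ⟶ Y.fst) (X.snd ⟶ Y.snd)

lemma homMk_comp {X Y Z : TensorCat k A B} (f : X.fst ⟶ Y.fst) (g : X.snd ⟶ Y.snd)
    (f' : Y.fst ⟶ Z.fst) (g' : Y.snd ⟶ Z.snd) :
    homMk f g ≫ homMk f' g' = (homMk (f ≫ f') (g ≫ g') : X ⟶ Z) := by
  change compₗ X Y Z (f ⊗ₜ g) (f' ⊗ₜ g') = _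
  simp [compₗ, homMk]

lemma hom_induction {X Y : TensorCat k A B} {P : (X ⟶ Y) → Prop} (f : X ⟶ Y) (zero : P 0)
    (homMk : ∀ a b, P (homMk a b)) (add : ∀ x y, P x → P y → P (x + y)) : P f :=
  TensorProduct.induction_on (motive := P) f zero homMk add

end TensorCat

/-- The tensor product sieve `R ⊠ S`: the image of `R ⊗ S` in `(A ⊗ B)(-, (a, b))`. -/
def LinSieve.box {a : A} {b : B} (R : LinSieve k a) (S : LinSieve k b) :
    LinSieve k (⟨a, b⟩ : TensorCat k A B) where
  arrows X := Submodule.map₂ (TensorCat.homMkₗ X ⟨a, b⟩) (R.arrows X.fst) (S.arrows X.snd)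
  comp_mem {X X'} h f hf := by
    have key : Submodule.map₂ (TensorCat.homMkₗ X ⟨a, b⟩) (R.arrows X.fst) (S.arrows X.snd) ≤
        (Submodule.map₂ (TensorCat.homMkₗ X' ⟨a, b⟩) (R.arrows X'.fst) (S.arrows X'.snd)).comap
          (Linear.leftComp k _ h) := by
      refine Submodule.map₂_le.2 fun r hr s hs => ?_
      rw [Submodule.mem_comap, Linear.leftComp_apply]
      induction h using TensorCat.hom_induction with
      | zero => simp
      | add x y hx hy => rw [Preadditive.add_comp]; exact add_mem hx hy
      | homMk x y =>
        change TensorCat.homMk x y ≫ TensorCat.homMk r s ∈ _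
        rw [TensorCat.homMk_comp]
        exact Submodule.apply_mem_map₂ (TensorCat.homMkₗ X' ⟨a, b⟩) (R.comp_mem x hr)
          (S.comp_mem y hs)
    exact key hf

/-- The tensor product topology: the smallest topology on `A ⊗ B` containing all sieves
`R ⊠ B(-, b)` with `R ∈ TA` and all sieves `A(-, a) ⊠ S` with `S ∈ TB`. -/
def tensorTopology (TA : CoverSystem k A) (TB : CoverSystem k B) :
    CoverSystem k (TensorCat k A B) :=
  CoverSystem.topGen fun X =>
    {Q | ∃ R ∈ TA X.fst, Q = LinSieve.box R (⊤ : LinSieve k X.snd)} ∪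
    {Q | ∃ S ∈ TB X.snd, Q = LinSieve.box (⊤ : LinSieve k X.fst) S}

end TensorProducts

/-! ### Tensor products of Grothendieck categories -/

section GrothendieckTensor

/-- A small `k`-linear site `(site, top)` with a `k`-linear functor to `C` that satisfies (LC) with
respect to the jointly epimorphic sieves of `C`. -/
structure LCMorphism (k : Type u) [CommRing k] (C : Type w) [Category.{v} C] [Preadditive C]
    [Linear k C] where
  site : Type u
  [category : Category.{u} site]
  [preadditive : Preadditive site]
  [linear : Linear k site]
  top : CoverSystem k site
  isTopology : top.IsTopology
  functor : site ⥤ C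
  additive_functor : functor.Additive
  linear_functor : functor.Linear k
  satisfiesLC : SatisfiesLC top functor (CoverSystem.jointlyEpi k C)

attribute [instance] LCMorphism.category LCMorphism.preadditive LCMorphism.linear

/-- `E` is the tensor product `C ⊠ D` of the `k`-linear (Grothendieck) categories `C` and `D`, which
is defined up to equivalence: there are LC morphisms to `C` and to `D`, and for arbitrary
LC morphisms `(a, Ta) ⟶ C` and `(b, Tb) ⟶ D`, `E` is equivalent to `Sh(a ⊗ b, Ta ⊠ Tb)`. -/
structure IsGrothendieckTensor (k : Type u) [CommRing k]
    (C : Type w) [Category.{v} C] [Preadditive C] [Linear k C]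
    (D : Type w₁) [Category.{v₁} D] [Preadditive D] [Linear k D]
    (E : Type w₂) [Category.{v₂} E] [Preadditive E] [Linear k E] : Prop where
  nonempty_left : Nonempty (LCMorphism.{u} k C)
  nonempty_right : Nonempty (LCMorphism.{u} k D)
  equivalent : ∀ (U : LCMorphism.{u} k C) (V : LCMorphism.{u} k D),
    LinearEquivalent k E (Sh (tensorTopology U.top V.top))

end GrothendieckTensor

/-! ### `ℤ`-algebras -/

section ZAlgebras

/-- A positively graded `ℤ`-algebra: a `k`-linear category with set of objects `ℤ` and
`𝔞(n, m) = 0` for `n < m`. Here `hom n m` is `𝔞(n, m)`, the morphisms from `n` to `m`, and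
`comp f g` is the composite of `f` followed by `g`. -/
structure ZAlgebra (k : Type u) [CommRing k] where
  hom : ℤ → ℤ → Type u
  [addCommGroup : ∀ n m, AddCommGroup (hom n m)]
  [module : ∀ n m, Module k (hom n m)]
  one : ∀ n, hom n n
  comp : ∀ {n m l}, hom n m →ₗ[k] hom m l →ₗ[k] hom n l
  one_comp : ∀ {n m} (f : hom n m), comp (one n) f = f
  comp_one : ∀ {n m} (f : hom n m), comp f (one m) = f
  assoc : ∀ {n m l p} (f : hom n m) (g : hom m l) (h : hom l p),
    comp (comp f g) h = comp f (comp g h)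
  eq_zero : ∀ {n m}, n < m → ∀ f : hom n m, f = 0

namespace ZAlgebra

attribute [instance] ZAlgebra.addCommGroup ZAlgebra.module

variable {k : Type u} [CommRing k]

/-- The objects of a `ℤ`-algebra, seen as a category: a copy of `ℤ`. -/
structure Obj (a : ZAlgebra.{u} k) : Type u where
  deg : ℤ

instance (a : ZAlgebra.{u} k) : Category.{u} a.Obj where
  Hom X Y := a.hom X.deg Y.deg
  id X := a.one X.deg
  comp f g := a.comp f g
  id_comp := a.one_comp
  comp_id := a.comp_one
  assoc := a.assoc

instance (a : ZAlgebra.{u} k) : Preadditive a.Obj where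
  homGroup X Y := a.addCommGroup X.deg Y.deg
  add_comp _ _ _ f f' g := LinearMap.map_add₂ a.comp f f' g
  comp_add _ _ _ f g g' := LinearMap.map_add (a.comp f) g g'

instance (a : ZAlgebra.{u} k) : Linear k a.Obj where
  homModule X Y := a.module X.deg Y.deg
  smul_comp _ _ _ r f g := LinearMap.map_smul₂ a.comp r f g
  comp_smul _ _ _ f r g := LinearMap.map_smul (a.comp f) r g

/-- Finite products (composites) of elements of the sets `X n m ⊆ 𝔞(n, m)`, the empty products
being the identities. -/
inductive IsProduct (a : ZAlgebra.{u} k) (X : ∀ n m, Set (a.hom n m)) :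
    ∀ {n m : ℤ}, a.hom n m → Prop
  | one (n : ℤ) : IsProduct a X (a.one n)
  | comp {n m l : ℤ} {f : a.hom n m} {g : a.hom m l} :
      f ∈ X n m → IsProduct a X g → IsProduct a X (a.comp f g)

/-- `a` is generated by `X`: every element is a linear combination of products of elements
of `X`. -/
def GeneratedBy (a : ZAlgebra.{u} k) (X : ∀ n m, Set (a.hom n m)) : Prop :=
  ∀ n m, Submodule.span k {f : a.hom n m | a.IsProduct X f} = ⊤

/-- `a` is generated in degrees `D ⊆ ℕ`: it is generated by some `X` with `X n m` empty
unless `n - m ∈ D`. -/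
def GeneratedInDegrees (a : ZAlgebra.{u} k) (D : Set ℕ) : Prop :=
  ∃ X : ∀ n m, Set (a.hom n m),
    (∀ n m : ℤ, (¬ ∃ d ∈ D, n - m = (d : ℤ)) → X n m = ∅) ∧ a.GeneratedBy X

/-- The tail sieve `𝔞(-, m)_{≥ n}`. -/
def tail (a : ZAlgebra.{u} k) (m : a.Obj) (n : ℤ) : LinSieve k m where
  arrows l := if n ≤ l.deg then ⊤ else ⊥
  comp_mem {l l'} g f hf := by
    by_cases h' : n ≤ l'.deg
    · rw [if_pos h']; trivial
    · rw [if_neg h', Submodule.mem_bot]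
      by_cases h : n ≤ l.deg
      · have hg : g = 0 := a.eq_zero (by omega) g
        rw [hg, Limits.zero_comp]
      · rw [if_neg h, Submodule.mem_bot] at hf
        rw [hf, Limits.comp_zero]

/-- The tails localizing system: all sieves on `m` that contain `𝔞(-, m)_{≥ n}` for
some `n ≥ m`. -/
def tailsSystem (a : ZAlgebra.{u} k) : CoverSystem k a.Obj :=
  fun m => {R | ∃ n : ℤ, m.deg ≤ n ∧ a.tail m n ≤ R}

/-- The tails topology. -/
def tailsTopology (a : ZAlgebra.{u} k) : CoverSystem k a.Obj :=
  a.tailsSystem.upglue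

/-- The diagonal `ℤ`-algebra `(𝔞 ⊗ 𝔟)_Δ`, with `(n, m) ↦ 𝔞(n, m) ⊗ 𝔟(n, m)`. -/
def diagonal (a b : ZAlgebra.{u} k) : ZAlgebra.{u} k where
  hom n m := a.hom n m ⊗[k] b.hom n m
  one n := a.one n ⊗ₜ b.one n
  comp := TensorProduct.map₂ a.comp b.comp
  one_comp {n m} f := Category.id_comp (X := (⟨⟨n⟩, ⟨n⟩⟩ : TensorCat k a.Obj b.Obj))
    (Y := ⟨⟨m⟩, ⟨m⟩⟩) f
  comp_one {n m} f := Category.comp_id (X := (⟨⟨n⟩, ⟨n⟩⟩ : TensorCat k a.Obj b.Obj))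
    (Y := ⟨⟨m⟩, ⟨m⟩⟩) f
  assoc {n m l p} f g h := Category.assoc (W := (⟨⟨n⟩, ⟨n⟩⟩ : TensorCat k a.Obj b.Obj))
    (X := ⟨⟨m⟩, ⟨m⟩⟩) (Y := ⟨⟨l⟩, ⟨l⟩⟩) (Z := ⟨⟨p⟩, ⟨p⟩⟩) f g h
  eq_zero {n m} h f := by
    induction f using TensorProduct.induction_on with
    | zero => rfl
    | tmul x y => rw [a.eq_zero h x, TensorProduct.zero_tmul]
    | add x y hx hy => rw [hx, hy, add_zero]

/-- The diagonal functor `Δ : (𝔞 ⊗ 𝔟)_Δ ⥤ 𝔞 ⊗ 𝔟`, `n ↦ (n, n)`, the identity on morphism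
modules. -/
def diagonalFunctor (a b : ZAlgebra.{u} k) : (a.diagonal b).Obj ⥤ TensorCat k a.Obj b.Obj where
  obj n := ⟨⟨n.deg⟩, ⟨n.deg⟩⟩
  map f := f
  map_id _ := rfl
  map_comp _ _ := rfl

instance (a b : ZAlgebra.{u} k) : (a.diagonalFunctor b).Additive where
  map_add := rfl

instance (a b : ZAlgebra.{u} k) : (a.diagonalFunctor b).Linear k where
  map_smul _ _ := rfl

end ZAlgebra

end ZAlgebras

end

set_option linter.unusedSectionVars false

noncomputable section

/-! ### Calculus of linear sieves -/

namespace LinSieve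

variable {k : Type u} [CommRing k] {C : Type w} [Category.{v} C] [Preadditive C] [Linear k C]

lemma le_trans' {A : C} {R S Q : LinSieve k A} (h : R ≤ S) (h' : S ≤ Q) : R ≤ Q :=
  fun B _ hf => h' B (h B hf)

lemma mem_top {A B : C} (f : B ⟶ A) : f ∈ (⊤ : LinSieve k A).arrows B :=
  Submodule.mem_top

lemma mem_pullback {A A' B : C} {R : LinSieve k A} {h : A' ⟶ A} {f : B ⟶ A'} :
    f ∈ (R.pullback h).arrows B ↔ f ≫ h ∈ R.arrows B := Iff.rfl

lemma pullback_eq_top {A A' : C} {R : LinSieve k A} {h : A' ⟶ A} (hh : h ∈ R.arrows A') :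
    R.pullback h = ⊤ := by
  ext B f
  exact ⟨fun _ => mem_top f, fun _ => R.comp_mem f hh⟩

lemma pullback_id {A : C} (R : LinSieve k A) : R.pullback (𝟙 A) = R := by
  ext B f
  rw [mem_pullback, Category.comp_id]

lemma pullback_comp {A A' A'' : C} (R : LinSieve k A) (h : A' ⟶ A) (h' : A'' ⟶ A') :
    R.pullback (h' ≫ h) = (R.pullback h).pullback h' := by
  ext B f
  simp only [mem_pullback, Category.assoc]

lemma pullback_mono {A A' : C} {R S : LinSieve k A} (hRS : R ≤ S) (h : A' ⟶ A) :
    R.pullback h ≤ S.pullback h := fun B _ hf => hRS B hf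

/-- Intersection of sieves. -/
def inter {A : C} (R S : LinSieve k A) : LinSieve k A where
  arrows B := R.arrows B ⊓ S.arrows B
  comp_mem g _ hf := ⟨R.comp_mem g hf.1, S.comp_mem g hf.2⟩

lemma inter_le_left {A : C} (R S : LinSieve k A) : R.inter S ≤ R := fun _ _ hf => hf.1

lemma inter_le_right {A : C} (R S : LinSieve k A) : R.inter S ≤ S := fun _ _ hf => hf.2

lemma mem_ofFamily {A : C} {ι : Type*} {X : ι → C} {f : ∀ i, X i ⟶ A} (i : ι) {B : C}
    (g : B ⟶ X i) : g ≫ f i ∈ (ofFamily k X f).arrows B :=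
  Submodule.subset_span ⟨i, g, rfl⟩

lemma mem_ofFamily_self {A : C} {ι : Type*} {X : ι → C} {f : ∀ i, X i ⟶ A} (i : ι) :
    f i ∈ (ofFamily k X f).arrows (X i) := by
  simpa using mem_ofFamily (k := k) (f := f) i (𝟙 _)

lemma ofFamily_le {A : C} {ι : Type*} {X : ι → C} {f : ∀ i, X i ⟶ A} {S : LinSieve k A}
    (h : ∀ i, f i ∈ S.arrows (X i)) : ofFamily k X f ≤ S := by
  intro B
  refine Submodule.span_le.2 ?_
  rintro _ ⟨i, g, rfl⟩
  exact S.comp_mem g (h i)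

/-- Conditions (F) and (FF) ask for families; this trades a covering sieve for the family of all its
arrows. -/
lemma le_ofFamily_self {A : C} (R : LinSieve k A) :
    R ≤ ofFamily k (ι := Σ B : C, R.arrows B) (fun i => i.1) (fun i => i.2.1) :=
  fun B f hf => mem_ofFamily_self (k := k) (X := fun i : Σ B : C, R.arrows B => i.1)
    (f := fun i => i.2.1) ⟨B, f, hf⟩

/-! ### Sieves transported along a functor -/

section Functor

variable {D : Type w₁} [Category.{v₁} D] [Preadditive D] [Linear k D] (φ : C ⥤ D)

lemma mem_map {A : C} {R : LinSieve k A} {B : C} {f : B ⟶ A} (hf : f ∈ R.arrows B) :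
    φ.map f ∈ (R.map φ).arrows (φ.obj B) :=
  mem_ofFamily_self (k := k) (X := fun i : Σ B : C, R.arrows B => φ.obj i.1)
    (f := fun i => φ.map i.2.1) ⟨B, f, hf⟩

lemma map_le {A : C} {R : LinSieve k A} {S : LinSieve k (φ.obj A)}
    (h : ∀ (B : C) (f : B ⟶ A), f ∈ R.arrows B → φ.map f ∈ S.arrows (φ.obj B)) :
    R.map φ ≤ S :=
  ofFamily_le fun i => h i.1 i.2.1 i.2.2

lemma map_mono {A : C} {R S : LinSieve k A} (h : R ≤ S) : R.map φ ≤ S.map φ :=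
  map_le φ fun B _ hf => mem_map φ (h B hf)

/-- The sieve on `X` generated by all morphisms from objects in the image of `φ`. -/
def imageSieve (X : D) : LinSieve k X :=
  ofFamily k (ι := Σ A : C, (φ.obj A ⟶ X)) (fun i => φ.obj i.1) (fun i => i.2)

lemma mem_imageSieve {X : D} {A : C} (x : φ.obj A ⟶ X) :
    x ∈ (imageSieve (k := k) φ X).arrows (φ.obj A) :=
  mem_ofFamily_self (k := k) (X := fun i : Σ A : C, (φ.obj A ⟶ X) => φ.obj i.1)
    (f := fun i => i.2) ⟨A, x⟩

lemma imageSieve_le {X : D} {S : LinSieve k X}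
    (h : ∀ (A : C) (x : φ.obj A ⟶ X), x ∈ S.arrows (φ.obj A)) : imageSieve φ X ≤ S :=
  ofFamily_le fun i => h i.1 i.2

variable [φ.Additive] [φ.Linear k]

/-- For `x : φ A ⟶ X` and a sieve `R` on `X`, the sieve of all `f` with `φ f ≫ x` in `R`. -/
def restrict {X : D} (R : LinSieve k X) {A : C} (x : φ.obj A ⟶ X) : LinSieve k A where
  arrows B := ((R.pullback x).arrows (φ.obj B)).comap (φ.mapLinearMap k)
  comp_mem g f hf := by
    change φ.map (g ≫ f) ≫ x ∈ R.arrows _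
    rw [φ.map_comp, Category.assoc]
    exact R.comp_mem _ hf

lemma mem_restrict {X : D} {R : LinSieve k X} {A : C} {x : φ.obj A ⟶ X} {B : C} {f : B ⟶ A} :
    f ∈ (R.restrict φ x).arrows B ↔ φ.map f ≫ x ∈ R.arrows (φ.obj B) := Iff.rfl

lemma top_le_restrict_zero {X : D} (R : LinSieve k X) {A : C} :
    ⊤ ≤ R.restrict φ (0 : φ.obj A ⟶ X) := fun B f _ => by
  rw [mem_restrict, Limits.comp_zero]
  exact zero_mem _

lemma inter_le_restrict_add {X : D} (R : LinSieve k X) {A : C} (x y : φ.obj A ⟶ X) :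
    (R.restrict φ x).inter (R.restrict φ y) ≤ R.restrict φ (x + y) := fun B f hf => by
  rw [mem_restrict, Preadditive.comp_add]
  exact add_mem hf.1 hf.2

/-- For `c : φ X ⟶ φ X'`, the sieve of all `a` such that `φ a ≫ c` is in the image of `φ`. -/
def liftSieve {X X' : C} (c : φ.obj X ⟶ φ.obj X') : LinSieve k X where
  arrows B := (LinearMap.range (φ.mapLinearMap k : (B ⟶ X') →ₗ[k] _)).comap
    (Linear.rightComp k (φ.obj B) c ∘ₗ φ.mapLinearMap k)
  comp_mem {B B'} g a ha := by
    obtain ⟨f, hf⟩ := ha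
    refine ⟨g ≫ f, ?_⟩
    change φ.map (g ≫ f) = φ.map (g ≫ a) ≫ c
    change φ.map f = φ.map a ≫ c at hf
    rw [φ.map_comp, hf, φ.map_comp, Category.assoc]

lemma mem_liftSieve {X X' : C} {c : φ.obj X ⟶ φ.obj X'} {B : C} {a : B ⟶ X} :
    a ∈ (liftSieve (k := k) φ c).arrows B ↔ ∃ f : B ⟶ X', φ.map f = φ.map a ≫ c := Iff.rfl

end Functor

/-- The sieve of all `a` with `a ≫ b = 0`. -/
def annihilator {X X' : C} (b : X ⟶ X') : LinSieve k X where
  arrows B := LinearMap.ker (Linear.rightComp k B b)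
  comp_mem g f hf := by
    change (g ≫ f) ≫ b = 0
    rw [Category.assoc, show f ≫ b = 0 from hf, Limits.comp_zero]

lemma mem_annihilator {X X' : C} {b : X ⟶ X'} {B : C} {a : B ⟶ X} :
    a ∈ (annihilator (k := k) b).arrows B ↔ a ≫ b = 0 := Iff.rfl

end LinSieve

/-! ### Consequences of the topology axioms -/

open LinSieve

namespace CoverSystem

variable {k : Type u} [CommRing k] {C : Type w} [Category.{v} C] [Preadditive C] [Linear k C]

namespace IsTopology

variable {T : CoverSystem k C} (hT : T.IsTopology)
include hT

/-- Glueing over `R`: the pullback of `S` along an arrow of `R` is the full sieve. -/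
lemma mem_of_le {A : C} {R S : LinSieve k A} (hR : R ∈ T A) (h : R ≤ S) : S ∈ T A :=
  hT.glueing S hR fun B f hf => by
    rw [pullback_eq_top (h B hf)]
    exact hT.identity B

lemma inter_mem {A : C} {R S : LinSieve k A} (hR : R ∈ T A) (hS : S ∈ T A) :
    R.inter S ∈ T A :=
  hT.glueing _ hR fun _ f hf =>
    hT.mem_of_le (hT.pullback f hS) fun _ g hg => ⟨R.comp_mem g hf, hg⟩

end IsTopology

/-- The closure of a sieve `S` for a topology: all `f` such that `f⁻¹ S` is covering. -/
def closure {T : CoverSystem k C} (hT : T.IsTopology) {A : C} (S : LinSieve k A) :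
    LinSieve k A where
  arrows B :=
    { carrier := {f | S.pullback f ∈ T B}
      zero_mem' := by
        rw [Set.mem_ofPred_eq, pullback_eq_top (zero_mem _)]
        exact hT.identity B
      add_mem' := fun {f g} hf hg => hT.mem_of_le (hT.inter_mem hf hg) fun Z x hx => by
        rw [mem_pullback, Preadditive.comp_add]
        exact add_mem hx.1 hx.2
      smul_mem' := fun r f hf => hT.mem_of_le hf fun Z x hx => by
        rw [mem_pullback, Linear.comp_smul]
        exact Submodule.smul_mem _ r hx }
  comp_mem g f hf := by
    change S.pullback (g ≫ f) ∈ T _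
    rw [pullback_comp]
    exact hT.pullback g hf

namespace IsTopology

variable {T : CoverSystem k C} (hT : T.IsTopology)
include hT

/-- The working form of glueing. Since the closure is itself a linear sieve, the inclusion need only
be checked on generators of `R`. -/
lemma mem_of_le_closure {A : C} {R S : LinSieve k A} (hR : R ∈ T A) (h : R ≤ closure hT S) :
    S ∈ T A :=
  hT.glueing S hR fun B _ hf => h B hf

end IsTopology

/-! ### Generated topologies -/

lemma topGen_isTopology (𝓡 : CoverSystem k C) : (topGen 𝓡).IsTopology where
  identity A _ hT _ := hT.identity A
  pullback h _ hR T hT h𝓡 := hT.pullback h (hR T hT h𝓡)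
  glueing S hR hS T hT h𝓡 :=
    hT.glueing S (hR T hT h𝓡) fun B f hf => hS B f hf T hT h𝓡

lemma subset_topGen (𝓡 : CoverSystem k C) (A : C) : 𝓡 A ⊆ topGen 𝓡 A :=
  fun _ hR _ _ h𝓡 => h𝓡 A hR

lemma topGen_subset {𝓡 T : CoverSystem k C} (hT : T.IsTopology) (h : ∀ A, 𝓡 A ⊆ T A) (A : C) :
    topGen 𝓡 A ⊆ T A :=
  fun _ hR => hR T hT h

/-- A topology is closed under enlarging and glueing, so an inclusion of the tails topology into a
topology can be tested on tails alone. -/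
lemma upglue_subset {𝓡 T : CoverSystem k C} (hT : T.IsTopology) (h : ∀ A, 𝓡 A ⊆ T A) (A : C) :
    𝓡.upglue A ⊆ T A := by
  intro R hR
  change UpGlue 𝓡 R at hR
  induction hR with
  | of hR => exact h _ hR
  | up _ hle ih => exact hT.mem_of_le ih hle
  | glue _ _ ih ih' => exact hT.glueing _ ih ih'

/-- Only pullbacks need an argument: stability of `𝓡` propagates through enlarging and glueing by
induction on how the sieve was obtained. -/
lemma upglue_isTopology {𝓡 : CoverSystem k C} (h1 : ∀ A, ⊤ ∈ 𝓡 A)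
    (h2 : ∀ {A A' : C} (h : A' ⟶ A) {R : LinSieve k A}, R ∈ 𝓡 A → R.pullback h ∈ 𝓡 A') :
    𝓡.upglue.IsTopology where
  identity A := .of (h1 A)
  pullback {A A'} h R hR := by
    change UpGlue 𝓡 R at hR
    change UpGlue 𝓡 _
    induction hR generalizing A' with
    | of hR => exact .of (h2 h hR)
    | up _ hle ih => exact .up (ih h) (pullback_mono hle h)
    | glue _ _ ih ih' =>
      refine .glue (ih h) fun B f hf => ?_
      rw [← pullback_comp]
      simpa only [pullback_id] using ih' B (f ≫ h) hf (𝟙 B)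
  glueing _ hR hS := .glue hR hS

/-! ### Topologies transported along a functor -/

section Functor

variable {D : Type w₁} [Category.{v₁} D] [Preadditive D] [Linear k D] (φ : C ⥤ D)

/-- All sieves `R` such that `φ (h⁻¹ R)` is covering for every `h`. -/
def stableInverse (T : CoverSystem k D) : CoverSystem k C :=
  fun A => {R | ∀ (A' : C) (h : A' ⟶ A), (R.pullback h).map φ ∈ T (φ.obj A')}

/-- For a general functor the inverse image of a topology need not be stable under pullback; the
quantification over all `h` builds this in. Thus an inclusion of a generated topology in an inverse
image can be checked on generators and their pullbacks. -/
lemma stableInverse_isTopology {T : CoverSystem k D} (hT : T.IsTopology) :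
    (T.stableInverse φ).IsTopology where
  identity A A' h := by
    refine hT.mem_of_le (hT.identity _) fun B f _ => ?_
    rw [← Category.comp_id f, ← φ.map_id]
    exact LinSieve.comp_mem _ f (mem_map φ (mem_top _))
  pullback h R hR A'' h' := by
    rw [← pullback_comp]
    exact hR _ _
  glueing {A R} S hR hS A' h := by
    refine hT.mem_of_le_closure (hR A' h) (map_le φ fun B f hf => ?_)
    have := hS B (f ≫ h) hf B (𝟙 B)
    rw [pullback_id, pullback_comp] at this
    refine hT.mem_of_le this (map_le φ fun B' g hg => ?_)
    rw [mem_pullback, ← φ.map_comp]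
    exact mem_map φ hg

lemma stableInverse_subset (T : CoverSystem k D) (A : C) :
    T.stableInverse φ A ⊆ T.inverseImage φ A := fun R hR => by
  have := hR A (𝟙 A)
  rwa [pullback_id] at this

variable [φ.Additive] [φ.Linear k]

/-- All sieves on `X` whose restriction along every `x : φ A ⟶ X` is covering. -/
def coinduced (T : CoverSystem k C) : CoverSystem k D :=
  fun X => {R | ∀ (A : C) (x : φ.obj A ⟶ X), R.restrict φ x ∈ T A}

/-- No (LC) hypothesis is needed, because restriction is along all morphisms from image objects.
This makes it possible to test on generators that restricting covers yields covers. -/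
lemma coinduced_isTopology {T : CoverSystem k C} (hT : T.IsTopology) :
    (T.coinduced φ).IsTopology where
  identity X A x := hT.mem_of_le (hT.identity A) fun _ _ _ => mem_top _
  pullback {X X'} h R hR A x :=
    hT.mem_of_le (hR A (x ≫ h)) fun B f hf => by
      rw [mem_restrict, mem_pullback, Category.assoc]
      exact hf
  glueing {X R} S hR hS A x := by
    refine hT.glueing _ (hR A x) fun B f hf => ?_
    refine hT.mem_of_le (hS _ (φ.map f ≫ x) hf B (𝟙 _)) fun B' g hg => ?_
    rw [mem_pullback, mem_restrict, φ.map_comp, Category.assoc]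
    rwa [mem_restrict, Category.comp_id, mem_pullback] at hg

end Functor

end CoverSystem

/-! ### Reformulation of condition (LC) -/

section LC

variable {k : Type u} [CommRing k]
  {A : Type w₁} [Category.{v₁} A] [Preadditive A] [Linear k A]
  {C : Type w₂} [Category.{v₂} C] [Preadditive C] [Linear k C]
  {φ : A ⥤ C} {TA : CoverSystem k A} {TC : CoverSystem k C}

lemma SatisfiesG.imageSieve_mem (h : SatisfiesG φ TC) (hTC : TC.IsTopology) (X : C) :
    imageSieve φ X ∈ TC X := by
  obtain ⟨ι, a, f, hf⟩ := h X
  exact hTC.mem_of_le hf (ofFamily_le fun i => mem_imageSieve φ (f i))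

lemma SatisfiesFF.annihilator_mem (h : SatisfiesFF TA φ) (hTA : TA.IsTopology) {X X' : A}
    {b : X ⟶ X'} (hb : φ.map b = 0) : annihilator b ∈ TA X := by
  obtain ⟨ι, Y, a, hY, ha⟩ := h X X' b hb
  exact hTA.mem_of_le hY (ofFamily_le ha)

variable [φ.Additive] [φ.Linear k]

lemma SatisfiesF.liftSieve_mem (h : SatisfiesF TA φ) (hTA : TA.IsTopology) {X X' : A}
    (c : φ.obj X ⟶ φ.obj X') : liftSieve φ c ∈ TA X := by
  obtain ⟨ι, Y, a, f, hY, ha⟩ := h X X' c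
  exact hTA.mem_of_le hY (ofFamily_le fun i => ⟨f i, (ha i).symm⟩)

/-- Locally, a morphism in the sieve `φ Q` comes from a morphism in `Q`. -/
lemma exists_lift_of_mem_map (hTA : TA.IsTopology)
    (hF : ∀ (X X' : A) (c : φ.obj X ⟶ φ.obj X'), liftSieve φ c ∈ TA X)
    {X : A} {Q : LinSieve k X} {Z : C} {h : Z ⟶ φ.obj X} (hh : h ∈ (Q.map φ).arrows Z)
    {B : A} (z : φ.obj B ⟶ Z) :
    ∃ R ∈ TA B, ∀ (B' : A) (b : B' ⟶ B), b ∈ R.arrows B' →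
      ∃ q ∈ Q.arrows B', φ.map q = φ.map b ≫ z ≫ h := by
  change h ∈ Submodule.span k _ at hh
  induction hh using Submodule.span_induction with
  | mem h hh =>
    obtain ⟨⟨B₀, q, hq⟩, g, rfl⟩ := hh
    -- For a generator `g ≫ φ q`, only `z ≫ g` has to be lifted locally, to some `f`; then `f ≫ q`
    -- stays in `Q`.
    refine ⟨_, hF B B₀ (z ≫ g), fun B' b hb => ?_⟩
    obtain ⟨f, hf⟩ := (mem_liftSieve φ).1 hb
    exact ⟨f ≫ q, Q.comp_mem f hq, by simp only [φ.map_comp, hf, Category.assoc]⟩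
  | zero => exact ⟨⊤, hTA.identity B, fun B' b _ => ⟨0, zero_mem _, by simp⟩⟩
  | add x y _ _ hx hy =>
    obtain ⟨R, hR, hR'⟩ := hx
    obtain ⟨S, hS, hS'⟩ := hy
    refine ⟨R.inter S, hTA.inter_mem hR hS, fun B' b hb => ?_⟩
    obtain ⟨q, hq, h⟩ := hR' B' b hb.1
    obtain ⟨q', hq', h'⟩ := hS' B' b hb.2
    exact ⟨q + q', add_mem hq hq', by simp [φ.map_add, h, h']⟩
  | smul r x _ hx =>
    obtain ⟨R, hR, hR'⟩ := hx
    refine ⟨R, hR, fun B' b hb => ?_⟩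
    obtain ⟨q, hq, h⟩ := hR' B' b hb
    exact ⟨r • q, Submodule.smul_mem _ r hq, by simp [φ.map_smul, h]⟩

namespace SatisfiesLC

/-- A criterion for (LC). -/
lemma of_sieves (hTA : TA.IsTopology)
    (hG : ∀ X, imageSieve φ X ∈ TC X)
    (hF : ∀ (X X' : A) (c : φ.obj X ⟶ φ.obj X'), liftSieve φ c ∈ TA X)
    (hFF : ∀ (X X' : A) (b : X ⟶ X'), φ.map b = 0 → annihilator b ∈ TA X)
    (h₁ : ∀ X, TA X ⊆ TC.inverseImage φ X) (h₂ : ∀ X, TC X ⊆ TA.coinduced φ X) :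
    SatisfiesLC TA φ TC where
  generating X := ⟨_, _, _, hG X⟩
  full X X' c := by
    have hmem := hTA.mem_of_le (hF X X' c) (le_ofFamily_self _)
    choose f hf using fun i : Σ B : A, (liftSieve (k := k) φ c).arrows B =>
      (mem_liftSieve φ).1 i.2.2
    exact ⟨_, _, _, f, hmem, fun i => (hf i).symm⟩
  faithful X X' b hb :=
    ⟨_, _, _, hTA.mem_of_le (hFF X X' b hb) (le_ofFamily_self _), fun i => i.2.2⟩
  topology_eq := by
    funext X
    refine Set.Subset.antisymm (h₁ X) fun Q hQ => ?_
    -- Restriction along the identity shows that the arrows `f` with `φ f` in `φ Q` form a cover, so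
    -- it is enough that each such `f` lies locally in `Q`.
    refine hTA.mem_of_le_closure (h₂ _ hQ X (𝟙 _)) fun B f hf => ?_
    rw [mem_restrict, Category.comp_id] at hf
    obtain ⟨R, hR, hRq⟩ := exists_lift_of_mem_map hTA hF hf (𝟙 _)
    refine hTA.mem_of_le_closure hR fun B' b hb => ?_
    obtain ⟨q, hq, hqb⟩ := hRq B' b hb
    rw [Category.id_comp, ← φ.map_comp] at hqb
    -- Now `q` and `b ≫ f` have the same image under `φ`, hence agree on a further cover.
    refine hTA.mem_of_le (hFF _ _ (q - b ≫ f) (by rw [φ.map_sub, hqb, sub_self]))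
      fun B'' g hg => ?_
    rw [mem_annihilator, Preadditive.comp_sub, sub_eq_zero] at hg
    rw [mem_pullback, mem_pullback, Category.assoc, ← hg]
    exact Q.comp_mem g hq

lemma map_mem (h : SatisfiesLC TA φ TC) {X : A} {R : LinSieve k X} (hR : R ∈ TA X) :
    R.map φ ∈ TC (φ.obj X) := by
  rw [h.topology_eq] at hR
  exact hR

/-- As `TA` is the inverse image of `TC`, it suffices that `φ` of the restriction covers. By (G) an
arrow `y` of `x⁻¹ R` may be precomposed with arrows `y'` from image objects, and by (F) the
composite `y' ≫ y` is locally some `φ f`; such an `f` belongs to the restriction. -/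
lemma restrict_mem (h : SatisfiesLC TA φ TC) (hTA : TA.IsTopology) (hTC : TC.IsTopology)
    {X : C} {R : LinSieve k X} (hR : R ∈ TC X) {B : A} (x : φ.obj B ⟶ X) :
    R.restrict φ x ∈ TA B := by
  rw [h.topology_eq]
  refine hTC.mem_of_le_closure (hTC.pullback x hR) fun Y y hy => ?_
  refine hTC.mem_of_le_closure (h.generating.imageSieve_mem hTC Y)
    (imageSieve_le φ fun B' y' => ?_)
  refine hTC.mem_of_le (h.map_mem (h.full.liftSieve_mem hTA (y' ≫ y))) (map_le φ ?_)
  rintro B'' l ⟨f, hf⟩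
  change φ.map f = φ.map l ≫ y' ≫ y at hf
  rw [mem_pullback, mem_pullback, Category.assoc, ← hf]
  refine mem_map φ ?_
  rw [mem_restrict, hf]
  simpa using R.comp_mem (φ.map l ≫ y') hy

end SatisfiesLC

end LC

/-! ### Morphisms tensored with a module -/

section RTensor

variable {k : Type u} [CommRing k]

/-- A tensor vanishes because of finitely many relations, so the vanishing already takes place over
a finitely generated submodule `P` of the target. No flatness is involved. -/
lemma exists_fg_rTensor_codRestrict_eq_zero {M M' N : Type*} [AddCommGroup M] [Module k M]
    [AddCommGroup M'] [Module k M'] [AddCommGroup N] [Module k N] (f : M →ₗ[k] M') {x : M ⊗[k] N}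
    (hx : f.rTensor N x = 0) :
    ∃ (J : Submodule k M) (y : J ⊗[k] N) (P : Submodule k M') (hJ : ∀ m ∈ J, f m ∈ P),
      P.FG ∧ J.subtype.rTensor N y = x ∧ (f.restrict hJ).rTensor N y = 0 := by
  obtain ⟨J, hJ, y, rfl⟩ := Submodule.exists_fg_le_eq_rTensor_subtype x
  have h₀ : ∀ m ∈ J, f m ∈ J.map f := fun m hm => Submodule.mem_map_of_mem hm
  have h₁ : (J.map f).subtype.rTensor N ((f.restrict h₀).rTensor N y) = 0 := by
    rw [← hx, ← LinearMap.rTensor_comp_apply, ← LinearMap.rTensor_comp_apply]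
    rfl
  obtain ⟨P, hP, hPfg, h₂⟩ := TensorProduct.eq_zero_of_fg_of_subtype_eq_zero (hJ.map f) h₁
  refine ⟨J, y, P, fun m hm => hP (h₀ m hm), hPfg, rfl, ?_⟩
  rw [← LinearMap.rTensor_comp_apply] at h₂
  exact h₂

variable {A : Type w₁} [Category.{v₁} A] [Preadditive A] [Linear k A]
  {C : Type w₂} [Category.{v₂} C] [Preadditive C] [Linear k C]
  {N : Type*} [AddCommGroup N] [Module k N]

namespace LinSieve

/-- For `x` in `A(X, X') ⊗ N`, the sieve of all `a` with `a ≫ x = 0`. -/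
def tensorAnnihilator {X X' : A} (x : (X ⟶ X') ⊗[k] N) : LinSieve k X where
  arrows B := LinearMap.ker
    (((LinearMap.rTensorHom N) ∘ₗ (Linear.comp B X X' : _ →ₗ[k] _)).flip x)
  comp_mem {B B'} g a ha := by
    change (Linear.leftComp k X' a).rTensor N x = 0 at ha
    change (Linear.leftComp k X' (g ≫ a)).rTensor N x = 0
    have h : Linear.leftComp k X' (g ≫ a) = Linear.leftComp k X' g ∘ₗ Linear.leftComp k X' a := by
      ext f; simp
    rw [h, LinearMap.rTensor_comp_apply, ha, map_zero]

lemma mem_tensorAnnihilator {X X' : A} {x : (X ⟶ X') ⊗[k] N} {B : A} {a : B ⟶ X} :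
    a ∈ (tensorAnnihilator x).arrows B ↔ (Linear.leftComp k X' a).rTensor N x = 0 := Iff.rfl

lemma mem_pullback_tensorAnnihilator {X X' : A} {x : (X ⟶ X') ⊗[k] N} {B B' : A} {a : B ⟶ X}
    {b : B' ⟶ B} : b ∈ ((tensorAnnihilator x).pullback a).arrows B' ↔
      (Linear.leftComp k X' b).rTensor N ((Linear.leftComp k X' a).rTensor N x) = 0 := by
  rw [mem_pullback, mem_tensorAnnihilator, ← LinearMap.rTensor_comp_apply]
  have h : Linear.leftComp k X' (b ≫ a) = Linear.leftComp k X' b ∘ₗ Linear.leftComp k X' a := by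
    ext f; simp
  rw [h]

end LinSieve

variable {φ : A ⥤ C} [φ.Additive] [φ.Linear k] {T : CoverSystem k A} (hT : T.IsTopology)
  (hF : ∀ (X X' : A) (c : φ.obj X ⟶ φ.obj X'), liftSieve φ c ∈ T X)
  (hFF : ∀ (X X' : A) (b : X ⟶ X'), φ.map b = 0 → annihilator b ∈ T X)
include hT

include hF in
-- Finite generation is what is needed here: one cover per generator, and only finite intersections
-- of covers are covers.
lemma exists_cover_lift_of_fg {X X' : A} {P : Submodule k (φ.obj X ⟶ φ.obj X')} (hP : P.FG) :
    ∃ R ∈ T X, ∀ (B : A) (a : B ⟶ X), a ∈ R.arrows B → ∀ y ∈ P,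
      φ.map a ≫ y ∈ LinearMap.range (φ.mapLinearMap k : (B ⟶ X') →ₗ[k] _) := by
  induction P, hP using Submodule.fg_induction with
  | singleton c =>
    refine ⟨_, hF _ _ c, fun B a ha y hy => ?_⟩
    obtain ⟨r, rfl⟩ := Submodule.mem_span_singleton.1 hy
    rw [Linear.comp_smul]
    exact Submodule.smul_mem _ r ha
  | sup P Q _ _ hP hQ =>
    obtain ⟨R, hR, hR'⟩ := hP
    obtain ⟨S, hS, hS'⟩ := hQ
    refine ⟨_, hT.inter_mem hR hS, fun B a ha y hy => ?_⟩
    obtain ⟨p, hp, q, hq, rfl⟩ := Submodule.mem_sup.1 hy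
    rw [Preadditive.comp_add]
    exact add_mem (hR' B a ha.1 p hp) (hS' B a ha.2 q hq)

include hF hFF

/-- Functors that are locally full and locally faithful stay locally faithful after tensoring the
morphism modules with a module. -/
lemma tensorAnnihilator_mem {X X' : A} {x : (X ⟶ X') ⊗[k] N}
    (hx : (φ.mapLinearMap k).rTensor N x = 0) : tensorAnnihilator x ∈ T X := by
  obtain ⟨J, y, P, hJ, hP, rfl, hy⟩ := exists_fg_rTensor_codRestrict_eq_zero _ hx
  obtain ⟨R, hR, hRP⟩ := exists_cover_lift_of_fg hT hF hP
  refine hT.mem_of_le_closure hR fun B a ha => ?_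
  let f : (B ⟶ X') →ₗ[k] (φ.obj B ⟶ φ.obj X') := φ.mapLinearMap k
  set x' := (Linear.leftComp k X' a).rTensor N (J.subtype.rTensor N y) with hx'
  -- Composition with `φ a` carries `P` into the image of `φ`, so the vanishing over `P` becomes
  -- vanishing in (image of `φ`) ⊗ `N`.
  have h₁ : f.rangeRestrict.rTensor N x' = 0 := by
    have h₂ : f.rangeRestrict ∘ₗ Linear.leftComp k X' a ∘ₗ J.subtype =
        ((Linear.leftComp k _ (φ.map a)).restrict (hRP B a ha)) ∘ₗ
          ((φ.mapLinearMap k).restrict hJ) := by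
      ext m
      change φ.map (a ≫ m.1) = φ.map a ≫ φ.map m.1
      exact φ.map_comp _ _
    rw [hx', ← LinearMap.rTensor_comp_apply, ← LinearMap.rTensor_comp_apply,
      LinearMap.comp_assoc, h₂,
      LinearMap.rTensor_comp_apply, hy, map_zero]
  have hex : Function.Exact (LinearMap.ker f).subtype f.rangeRestrict := by
    rw [LinearMap.exact_iff, LinearMap.ker_rangeRestrict, Submodule.range_subtype]
  -- Right exactness of `- ⊗ N`: the restricted element comes from `ker φ ⊗ N`, a finite sum of
  -- terms `p ⊗ n` to which (FF) applies.
  obtain ⟨z, hz⟩ := (rTensor_exact N hex f.surjective_rangeRestrict _).1 h₁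
  suffices H : ∀ z : (LinearMap.ker f) ⊗[k] N,
      tensorAnnihilator ((LinearMap.ker f).subtype.rTensor N z) ∈ T B by
    refine hT.mem_of_le (H z) fun B' b hb => ?_
    rw [mem_pullback_tensorAnnihilator]
    rwa [mem_tensorAnnihilator, hz] at hb
  intro z
  induction z with
  | zero =>
    refine hT.mem_of_le (hT.identity B) fun B' b _ => ?_
    rw [mem_tensorAnnihilator, map_zero, map_zero]
  | tmul p n =>
    refine hT.mem_of_le (hFF _ _ p.1 p.2) fun B' b hb => ?_
    rw [mem_annihilator] at hb
    rw [mem_tensorAnnihilator]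
    simp [hb]
  | add z z' h h' =>
    refine hT.mem_of_le (hT.inter_mem h h') fun B' b hb => ?_
    have h1 := mem_tensorAnnihilator.1 hb.1
    have h2 := mem_tensorAnnihilator.1 hb.2
    rw [mem_tensorAnnihilator, map_add, map_add, h1, h2, add_zero]

/-- The mirror image of `tensorAnnihilator_mem`. -/
lemma exists_cover_lTensor_eq_zero {X X' : A} {x : N ⊗[k] (X ⟶ X')}
    (hx : (φ.mapLinearMap k).lTensor N x = 0) :
    ∃ R ∈ T X, ∀ (B : A) (a : B ⟶ X), a ∈ R.arrows B →
      (Linear.leftComp k X' a).lTensor N x = 0 := by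
  have hx' : (φ.mapLinearMap k).rTensor N (TensorProduct.comm k _ _ x) = 0 := by
    rw [← LinearMap.comm_comp_lTensor_comp_comm_eq]
    simp [hx]
  refine ⟨_, tensorAnnihilator_mem hT hF hFF hx', fun B a ha => ?_⟩
  rw [mem_tensorAnnihilator, ← LinearMap.comm_comp_lTensor_comp_comm_eq] at ha
  simpa using ha

end RTensor

/-! ### The tensor product of linear sites -/

section TensorSites

variable {k : Type u} [CommRing k]
  {A : Type w₁} [Category.{v₁} A] [Preadditive A] [Linear k A]
  {B : Type w₂} [Category.{v₂} B] [Preadditive B] [Linear k B]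

namespace TensorCat

lemma homMk_comp_eq {X Y : TensorCat k A B} (f : X.fst ⟶ Y.fst) (g : X.snd ⟶ Y.snd)
    {Z : TensorCat k A B} (h : Y ⟶ Z) :
    homMk f g ≫ h = TensorProduct.map (Linear.leftComp k _ f) (Linear.leftComp k _ g) h := by
  induction h using hom_induction with
  | zero => rw [Limits.comp_zero]; exact (map_zero _).symm
  | homMk a b => rw [homMk_comp]; rfl
  | add x y hx hy => rw [Preadditive.comp_add, hx, hy]; exact (map_add _ _ _).symm

end TensorCat

namespace LinSieve

open TensorCat

lemma homMk_mem_box {X : TensorCat k A B} {R : LinSieve k X.fst} {S : LinSieve k X.snd}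
    {Y : TensorCat k A B} {r : Y.fst ⟶ X.fst} {s : Y.snd ⟶ X.snd}
    (hr : r ∈ R.arrows Y.fst) (hs : s ∈ S.arrows Y.snd) :
    (homMk r s : Y ⟶ X) ∈ (R.box S).arrows Y :=
  Submodule.apply_mem_map₂ (homMkₗ Y X) hr hs

lemma box_le {X : TensorCat k A B} {R : LinSieve k X.fst} {S : LinSieve k X.snd}
    {Q : LinSieve k X}
    (h : ∀ (Y : TensorCat k A B) (r : Y.fst ⟶ X.fst) (s : Y.snd ⟶ X.snd),
      r ∈ R.arrows Y.fst → s ∈ S.arrows Y.snd → (homMk r s : Y ⟶ X) ∈ Q.arrows Y) :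
    R.box S ≤ Q :=
  fun Y => Submodule.map₂_le.2 fun r hr s hs => h Y r s hr hs

lemma box_mono {X : TensorCat k A B} {R R' : LinSieve k X.fst} {S S' : LinSieve k X.snd}
    (hR : R ≤ R') (hS : S ≤ S') : R.box S ≤ (R'.box S' : LinSieve k X) :=
  box_le fun Y _ _ hr hs => homMk_mem_box (hR Y.fst hr) (hS Y.snd hs)

/-- The box of two generated sieves is generated by the products of the generators, by bilinearity.
-/
lemma box_ofFamily_le {X : TensorCat k A B} {ι κ : Type*} {a : ι → A} {f : ∀ i, a i ⟶ X.fst}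
    {b : κ → B} {g : ∀ j, b j ⟶ X.snd} {Q : LinSieve k X}
    (h : ∀ i j, (homMk (f i) (g j) : (⟨a i, b j⟩ : TensorCat k A B) ⟶ X) ∈ Q.arrows ⟨a i, b j⟩) :
    (ofFamily k a f).box (ofFamily k b g) ≤ Q := by
  intro Y
  refine (Submodule.map₂_span_span k (homMkₗ Y X) _ _).trans_le (Submodule.span_le.2 ?_)
  rintro _ ⟨_, ⟨i, r, rfl⟩, _, ⟨j, s, rfl⟩, rfl⟩
  have := Q.comp_mem (homMk r s : Y ⟶ ⟨a i, b j⟩) (h i j)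
  rwa [homMk_comp] at this

end LinSieve

open TensorCat

variable {TA : CoverSystem k A} {TB : CoverSystem k B}

lemma tensorTopology_isTopology (TA : CoverSystem k A) (TB : CoverSystem k B) :
    (tensorTopology TA TB).IsTopology :=
  CoverSystem.topGen_isTopology _

lemma box_top_mem_tensorTopology {X : TensorCat k A B} {R : LinSieve k X.fst}
    (hR : R ∈ TA X.fst) : R.box (⊤ : LinSieve k X.snd) ∈ tensorTopology TA TB X :=
  CoverSystem.subset_topGen _ X (Or.inl ⟨R, hR, rfl⟩)

lemma top_box_mem_tensorTopology {X : TensorCat k A B} {S : LinSieve k X.snd}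
    (hS : S ∈ TB X.snd) : (⊤ : LinSieve k X.fst).box S ∈ tensorTopology TA TB X :=
  CoverSystem.subset_topGen _ X (Or.inr ⟨S, hS, rfl⟩)

lemma tensorTopology_subset {T : CoverSystem k (TensorCat k A B)} (hT : T.IsTopology)
    (h₁ : ∀ (X : TensorCat k A B) (R : LinSieve k X.fst), R ∈ TA X.fst →
      R.box (⊤ : LinSieve k X.snd) ∈ T X)
    (h₂ : ∀ (X : TensorCat k A B) (S : LinSieve k X.snd), S ∈ TB X.snd →
      (⊤ : LinSieve k X.fst).box S ∈ T X) (X : TensorCat k A B) :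
    tensorTopology TA TB X ⊆ T X := by
  refine CoverSystem.topGen_subset hT (fun X => ?_) X
  rintro _ (⟨R, hR, rfl⟩ | ⟨S, hS, rfl⟩)
  · exact h₁ X R hR
  · exact h₂ X S hS

/-- A sieve on `(a, b)` is covering if, for the morphisms `r` in a covering sieve on `a`, the
morphisms `s` with `r ⊗ s` in the sieve contain a covering sieve on `b`. -/
lemma mem_tensorTopology_of_slices (hTB : TB.IsTopology) {X : TensorCat k A B}
    {Q : LinSieve k X} {R : LinSieve k X.fst} (hR : R ∈ TA X.fst)
    (h : ∀ (a : A) (r : a ⟶ X.fst), r ∈ R.arrows a → ∃ S ∈ TB X.snd,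
      ∀ (b : B) (s : b ⟶ X.snd), s ∈ S.arrows b →
        (homMk r s : (⟨a, b⟩ : TensorCat k A B) ⟶ X) ∈ Q.arrows ⟨a, b⟩) :
    Q ∈ tensorTopology TA TB X := by
  have hT := tensorTopology_isTopology TA TB
  refine hT.mem_of_le_closure (box_top_mem_tensorTopology hR) (box_le fun Y r g hr _ => ?_)
  obtain ⟨S, hS, hSQ⟩ := h Y.fst r hr
  -- The cover `S` may depend on `r`; it is pulled back along `g`, and `(f ⊗ s) ≫ (r ⊗ g)` is then
  -- rewritten as `(f ⊗ 1) ≫ (r ⊗ (s ≫ g))`.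
  refine hT.mem_of_le (top_box_mem_tensorTopology (hTB.pullback g hS)) (box_le fun Z f s _ hs => ?_)
  rw [mem_pullback, homMk_comp]
  have := Q.comp_mem (homMk f (𝟙 Z.snd) : Z ⟶ ⟨Y.fst, Z.snd⟩) (hSQ Z.snd (s ≫ g) hs)
  rwa [homMk_comp, Category.id_comp] at this

lemma box_mem_tensorTopology (hTB : TB.IsTopology) {X : TensorCat k A B} {R : LinSieve k X.fst}
    {S : LinSieve k X.snd} (hR : R ∈ TA X.fst) (hS : S ∈ TB X.snd) :
    R.box S ∈ tensorTopology TA TB X :=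
  mem_tensorTopology_of_slices hTB hR fun _ _ hr => ⟨S, hS, fun _ _ hs => homMk_mem_box hr hs⟩

/-- A morphism of the tensor category is a finite sum of pure tensors: intersect the pullbacks of
`R` along the first factors. This handles the pullbacks in `stableInverse`. -/
lemma exists_box_top_le_pullback (hTA : TA.IsTopology) {X Y : TensorCat k A B}
    {R : LinSieve k X.fst} (hR : R ∈ TA X.fst) (h : Y ⟶ X) :
    ∃ R' ∈ TA Y.fst, R'.box (⊤ : LinSieve k Y.snd) ≤
      (R.box (⊤ : LinSieve k X.snd)).pullback h := by
  induction h using hom_induction with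
  | zero => exact ⟨⊤, hTA.identity _, fun Z f _ => by
      rw [mem_pullback, Limits.comp_zero]; exact zero_mem _⟩
  | homMk f g => exact ⟨R.pullback f, hTA.pullback f hR, box_le fun Z r s hr _ => by
      rw [mem_pullback, homMk_comp]; exact homMk_mem_box hr (mem_top _)⟩
  | add x y hx hy =>
    obtain ⟨R₁, hR₁, h₁⟩ := hx
    obtain ⟨R₂, hR₂, h₂⟩ := hy
    refine ⟨_, hTA.inter_mem hR₁ hR₂, box_le fun Z r s hr hs => ?_⟩
    rw [mem_pullback, Preadditive.comp_add]
    exact add_mem (h₁ Z (homMk_mem_box hr.1 hs)) (h₂ Z (homMk_mem_box hr.2 hs))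

lemma exists_top_box_le_pullback (hTB : TB.IsTopology) {X Y : TensorCat k A B}
    {S : LinSieve k X.snd} (hS : S ∈ TB X.snd) (h : Y ⟶ X) :
    ∃ S' ∈ TB Y.snd, (⊤ : LinSieve k Y.fst).box S' ≤
      ((⊤ : LinSieve k X.fst).box S).pullback h := by
  induction h using hom_induction with
  | zero => exact ⟨⊤, hTB.identity _, fun Z f _ => by
      rw [mem_pullback, Limits.comp_zero]; exact zero_mem _⟩
  | homMk f g => exact ⟨S.pullback g, hTB.pullback g hS, box_le fun Z r s _ hs => by
      rw [mem_pullback, homMk_comp]; exact homMk_mem_box (mem_top _) hs⟩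
  | add x y hx hy =>
    obtain ⟨S₁, hS₁, h₁⟩ := hx
    obtain ⟨S₂, hS₂, h₂⟩ := hy
    refine ⟨_, hTB.inter_mem hS₁ hS₂, box_le fun Z r s hr hs => ?_⟩
    rw [mem_pullback, Preadditive.comp_add]
    exact add_mem (h₁ Z (homMk_mem_box hr hs.1)) (h₂ Z (homMk_mem_box hr hs.2))

/-- Boxing with a full sieve respects enlarging and glueing, so membership in a topology passes from
the generating system to its closure. -/
lemma box_top_mem_of_upglue {T : CoverSystem k (TensorCat k A B)} (hT : T.IsTopology)
    {𝓡 : CoverSystem k A}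
    (h : ∀ (X : TensorCat k A B) (R : LinSieve k X.fst), R ∈ 𝓡 X.fst →
      R.box (⊤ : LinSieve k X.snd) ∈ T X) {X : TensorCat k A B} {R : LinSieve k X.fst}
    (hR : R ∈ 𝓡.upglue X.fst) : R.box (⊤ : LinSieve k X.snd) ∈ T X := by
  obtain ⟨x, y⟩ := X
  replace hR : CoverSystem.UpGlue (A := x) 𝓡 R := hR
  dsimp only at R
  induction hR generalizing y with
  | of hR => exact h ⟨_, y⟩ _ hR
  | up _ hle ih => exact hT.mem_of_le (ih y) (box_mono hle fun _ _ h => h)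
  | glue _ _ ih ih' =>
    refine hT.mem_of_le_closure (ih y) (box_le fun Y r s hr _ => ?_)
    refine hT.mem_of_le (ih' _ r hr Y.snd) (box_le fun Z f g hf _ => ?_)
    rw [mem_pullback, homMk_comp]
    exact homMk_mem_box hf (mem_top _)

lemma top_box_mem_of_upglue {T : CoverSystem k (TensorCat k A B)} (hT : T.IsTopology)
    {𝓡 : CoverSystem k B}
    (h : ∀ (X : TensorCat k A B) (S : LinSieve k X.snd), S ∈ 𝓡 X.snd →
      (⊤ : LinSieve k X.fst).box S ∈ T X) {X : TensorCat k A B} {S : LinSieve k X.snd}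
    (hS : S ∈ 𝓡.upglue X.snd) : (⊤ : LinSieve k X.fst).box S ∈ T X := by
  obtain ⟨x, y⟩ := X
  replace hS : CoverSystem.UpGlue (A := y) 𝓡 S := hS
  dsimp only at S
  induction hS generalizing x with
  | of hS => exact h ⟨x, _⟩ _ hS
  | up _ hle ih => exact hT.mem_of_le (ih x) (box_mono (fun _ _ h => h) hle)
  | glue _ _ ih ih' =>
    refine hT.mem_of_le_closure (ih x) (box_le fun Y r s _ hs => ?_)
    refine hT.mem_of_le (ih' _ s hs Y.fst) (box_le fun Z f g _ hg => ?_)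
    rw [mem_pullback, homMk_comp]
    exact homMk_mem_box (mem_top _) hg

end TensorSites

/-! ### Tensor products of functors -/

section TensorFunctors

open TensorCat

variable {k : Type u} [CommRing k]
  {A : Type*} [Category A] [Preadditive A] [Linear k A]
  {B : Type*} [Category B] [Preadditive B] [Linear k B]
  {C : Type*} [Category C] [Preadditive C] [Linear k C]
  {D : Type*} [Category D] [Preadditive D] [Linear k D]
  (φ : A ⥤ C) (ψ : B ⥤ D) [φ.Additive] [φ.Linear k] [ψ.Additive] [ψ.Linear k]

variable (k) in
/-- The tensor product `φ ⊗ ψ` of `k`-linear functors. -/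
def tensorFunctor : TensorCat k A B ⥤ TensorCat k C D where
  obj X := ⟨φ.obj X.fst, ψ.obj X.snd⟩
  map {X Y} f := TensorProduct.map (φ.mapLinearMap k : (X.fst ⟶ Y.fst) →ₗ[k] _)
    (ψ.mapLinearMap k : (X.snd ⟶ Y.snd) →ₗ[k] _) f
  map_id X := by
    change φ.map (𝟙 X.fst) ⊗ₜ[k] ψ.map (𝟙 X.snd) = _
    rw [φ.map_id, ψ.map_id]
    rfl
  map_comp {X Y Z} f g := by
    induction f using hom_induction with
    | zero => rw [Limits.zero_comp]; erw [map_zero, map_zero]; rw [Limits.zero_comp]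
    | add x y hx hy =>
      rw [Preadditive.add_comp]
      erw [map_add, map_add]
      rw [hx, hy]
      exact (Preadditive.add_comp _ _ _ _ _ _).symm
    | homMk a b =>
      induction g using hom_induction with
      | zero => rw [Limits.comp_zero]; erw [map_zero, map_zero]; rw [Limits.comp_zero]
      | add x y hx hy =>
        rw [Preadditive.comp_add]
        erw [map_add, map_add]
        rw [hx, hy]
        exact (Preadditive.comp_add _ _ _ _ _ _).symm
      | homMk a' b' =>
        rw [homMk_comp]
        change φ.map (a ≫ a') ⊗ₜ[k] ψ.map (b ≫ b') = _
        rw [φ.map_comp, ψ.map_comp]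
        exact (homMk_comp (X := ⟨φ.obj X.fst, ψ.obj X.snd⟩) (Y := ⟨φ.obj Y.fst, ψ.obj Y.snd⟩)
          (Z := ⟨φ.obj Z.fst, ψ.obj Z.snd⟩) (φ.map a) (ψ.map b) (φ.map a') (ψ.map b')).symm

instance : (tensorFunctor k φ ψ).Additive where
  map_add {_ _ f g} := map_add (TensorProduct.map (φ.mapLinearMap k) (ψ.mapLinearMap k)) f g

instance : (tensorFunctor k φ ψ).Linear k where
  map_smul f r := map_smul (TensorProduct.map (φ.mapLinearMap k) (ψ.mapLinearMap k)) r f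

lemma tensorFunctor_map_homMk {X Y : TensorCat k A B} (f : X.fst ⟶ Y.fst) (g : X.snd ⟶ Y.snd) :
    (tensorFunctor k φ ψ).map (homMk f g : X ⟶ Y) = homMk (φ.map f) (ψ.map g) := rfl

variable {φ ψ} {TA : CoverSystem k A} {TB : CoverSystem k B} {TC : CoverSystem k C}
  {TD : CoverSystem k D}

/-- On generators, `φ r ⊗ ψ s` is the image of `r ⊗ s` under `φ ⊗ ψ`. -/
lemma box_map_le_map {X : TensorCat k A B} {R : LinSieve k X.fst} {S : LinSieve k X.snd}
    {R' : LinSieve k (φ.obj X.fst)} {S' : LinSieve k (ψ.obj X.snd)}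
    (hR : R' ≤ R.map φ) (hS : S' ≤ S.map ψ) :
    (R'.box S' : LinSieve k ((tensorFunctor k φ ψ).obj X)) ≤ (R.box S).map (tensorFunctor k φ ψ) :=
  le_trans' (box_mono (X := (tensorFunctor k φ ψ).obj X) hR hS) <|
    box_ofFamily_le fun i j =>
      mem_map (tensorFunctor k φ ψ) (B := ⟨i.1, j.1⟩) (homMk_mem_box (X := X) i.2.2 j.2.2)

/-- (LC) functors are stable under tensor products. -/
theorem SatisfiesLC.tensor (hTA : TA.IsTopology) (hTB : TB.IsTopology) (hTC : TC.IsTopology)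
    (hTD : TD.IsTopology) (hφ : SatisfiesLC TA φ TC) (hψ : SatisfiesLC TB ψ TD) :
    SatisfiesLC (tensorTopology TA TB) (tensorFunctor k φ ψ) (tensorTopology TC TD) := by
  have hT := tensorTopology_isTopology TA TB
  have hT' := tensorTopology_isTopology TC TD
  refine SatisfiesLC.of_sieves hT ?_ ?_ ?_ ?_ ?_
  · intro X
    refine hT'.mem_of_le (box_mem_tensorTopology hTD
      (hφ.generating.imageSieve_mem hTC X.fst) (hψ.generating.imageSieve_mem hTD X.snd)) ?_
    refine box_ofFamily_le fun i j => ?_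
    exact mem_imageSieve (tensorFunctor k φ ψ) (A := ⟨i.1, j.1⟩) (homMk i.2 j.2)
  · intro X X' c
    induction c using hom_induction with
    | zero => exact hT.mem_of_le (hT.identity X) fun Y f _ => ⟨0, by simp⟩
    | add x y hx hy =>
      refine hT.mem_of_le (hT.inter_mem hx hy) ?_
      rintro Y f ⟨⟨a, ha⟩, ⟨b, hb⟩⟩
      refine ⟨a + b, ?_⟩
      change (tensorFunctor k φ ψ).map a = _ at ha
      change (tensorFunctor k φ ψ).map b = _ at hb
      change (tensorFunctor k φ ψ).map (a + b) = (tensorFunctor k φ ψ).map f ≫ (x + y)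
      rw [Functor.map_add, ha, hb, Preadditive.comp_add]
      rfl
    | homMk c d =>
      refine hT.mem_of_le (box_mem_tensorTopology hTB (hφ.full.liftSieve_mem hTA c)
        (hψ.full.liftSieve_mem hTB d)) (box_le fun Y r s hr hs => ?_)
      obtain ⟨f, hf⟩ := (mem_liftSieve φ).1 hr
      obtain ⟨g, hg⟩ := (mem_liftSieve ψ).1 hs
      refine (mem_liftSieve _).2 ⟨homMk f g, ?_⟩
      rw [tensorFunctor_map_homMk, tensorFunctor_map_homMk, hf, hg]
      exact (homMk_comp (X := (tensorFunctor k φ ψ).obj Y) (Y := (tensorFunctor k φ ψ).obj X)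
        (Z := (tensorFunctor k φ ψ).obj X') _ _ _ _).symm
  · intro X X' b hb
    -- The two functors are treated one at a time: local faithfulness of `φ`, with coefficients in a
    -- morphism module of `D`, kills `(1 ⊗ ψ) b` on a cover `R`. For each `r` in `R`, the element
    -- `(r ⊗ 1) b` then has zero image under `1 ⊗ ψ`, and `ψ` yields a cover depending on `r`.
    obtain ⟨R, hR, hRb⟩ : ∃ R ∈ TA X.fst, ∀ (a : A) (r : a ⟶ X.fst), r ∈ R.arrows a →
        (Linear.leftComp k X'.fst r).rTensor _
          ((ψ.mapLinearMap k : (X.snd ⟶ X'.snd) →ₗ[k] _).lTensor _ b) = 0 := by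
      refine ⟨_, tensorAnnihilator_mem (φ := φ) hTA (fun _ _ c => hφ.full.liftSieve_mem hTA c)
        (fun _ _ b hb => hφ.faithful.annihilator_mem hTA hb)
        (x := (ψ.mapLinearMap k : (X.snd ⟶ X'.snd) →ₗ[k] _).lTensor _ b) ?_,
        fun a r hr => mem_tensorAnnihilator.1 hr⟩
      rw [← LinearMap.comp_apply, LinearMap.rTensor_comp_lTensor]
      exact hb
    refine mem_tensorTopology_of_slices hTB hR fun a r hr => ?_
    have h := hRb a r hr
    rw [← LinearMap.comp_apply, LinearMap.rTensor_comp_lTensor, ← LinearMap.lTensor_comp_rTensor,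
      LinearMap.comp_apply] at h
    obtain ⟨S, hS, hSb⟩ := exists_cover_lTensor_eq_zero hTB
      (fun _ _ c => hψ.full.liftSieve_mem hTB c)
      (fun _ _ b hb => hψ.faithful.annihilator_mem hTB hb) h
    refine ⟨S, hS, fun b' s hs => ?_⟩
    have := hSb b' s hs
    rw [← LinearMap.comp_apply, LinearMap.lTensor_comp_rTensor] at this
    rw [mem_annihilator, homMk_comp_eq]
    exact this
  · intro X
    refine Set.Subset.trans (tensorTopology_subset
      (CoverSystem.stableInverse_isTopology (tensorFunctor k φ ψ) hT') ?_ ?_ X)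
      (CoverSystem.stableInverse_subset _ _ X)
    · intro X R hR Y h
      obtain ⟨R', hR', hle⟩ := exists_box_top_le_pullback hTA hR h
      refine hT'.mem_of_le (box_top_mem_tensorTopology (hφ.map_mem hR')) (le_trans' ?_
        (map_mono _ hle))
      refine box_map_le_map (ψ := ψ) (S := ⊤) (fun _ _ h => h) (fun Z f _ => ?_)
      rw [← Category.comp_id f, ← ψ.map_id]
      exact LinSieve.comp_mem _ f (mem_map ψ (mem_top _))
    · intro X S hS Y h
      obtain ⟨S', hS', hle⟩ := exists_top_box_le_pullback hTB hS h
      refine hT'.mem_of_le (top_box_mem_tensorTopology (hψ.map_mem hS')) (le_trans' ?_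
        (map_mono _ hle))
      refine box_map_le_map (φ := φ) (R := ⊤) (fun Z f _ => ?_) (fun _ _ h => h)
      rw [← Category.comp_id f, ← φ.map_id]
      exact LinSieve.comp_mem _ f (mem_map φ (mem_top _))
  · refine tensorTopology_subset (CoverSystem.coinduced_isTopology _ hT) ?_ ?_
    · intro X R hR Y x
      induction x using hom_induction with
      | zero => exact hT.mem_of_le (hT.identity Y) (top_le_restrict_zero _ _)
      | add x y hx hy => exact hT.mem_of_le (hT.inter_mem hx hy) (inter_le_restrict_add _ _ _ _)
      | homMk c d =>
        refine hT.mem_of_le (box_top_mem_tensorTopology (hφ.restrict_mem hTA hTC hR c))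
          (box_le fun Z f g hf _ => ?_)
        rw [mem_restrict, tensorFunctor_map_homMk]
        erw [homMk_comp]
        exact homMk_mem_box hf (mem_top _)
    · intro X S hS Y x
      induction x using hom_induction with
      | zero => exact hT.mem_of_le (hT.identity Y) (top_le_restrict_zero _ _)
      | add x y hx hy => exact hT.mem_of_le (hT.inter_mem hx hy) (inter_le_restrict_add _ _ _ _)
      | homMk c d =>
        refine hT.mem_of_le (top_box_mem_tensorTopology (hψ.restrict_mem hTB hTD hS d))
          (box_le fun Z f g _ hg => ?_)
        rw [mem_restrict, tensorFunctor_map_homMk]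
        erw [homMk_comp]
        exact homMk_mem_box (mem_top _) hg

end TensorFunctors

/-! ### The diagonal of two `ℤ`-algebras -/

namespace ZAlgebra

open TensorCat

variable {k : Type u} [CommRing k] (a b : ZAlgebra.{u} k)

variable {a} in
lemma mem_tail {m l : a.Obj} {n : ℤ} (h : n ≤ l.deg) (f : l ⟶ m) : f ∈ (a.tail m n).arrows l := by
  change f ∈ (if n ≤ l.deg then ⊤ else ⊥ : Submodule k (l ⟶ m))
  rw [if_pos h]
  trivial

variable {a} in
lemma tail_le {m : a.Obj} {n : ℤ} {R : LinSieve k m}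
    (h : ∀ (l : a.Obj) (f : l ⟶ m), n ≤ l.deg → f ∈ R.arrows l) : a.tail m n ≤ R := by
  intro l f hf
  change f ∈ (if n ≤ l.deg then ⊤ else ⊥ : Submodule k (l ⟶ m)) at hf
  split_ifs at hf with hl
  · exact h l f hl
  · rw [(Submodule.mem_bot k).1 hf]
    exact zero_mem _

lemma pullback_mem_tailsSystem {m m' : a.Obj} (h : m' ⟶ m) {R : LinSieve k m}
    (hR : R ∈ a.tailsSystem m) : R.pullback h ∈ a.tailsSystem m' := by
  obtain ⟨n, -, hn⟩ := hR
  exact ⟨max n m'.deg, le_max_right _ _, tail_le fun l f hl =>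
    hn l (mem_tail ((le_max_left _ _).trans hl) _)⟩

lemma tailsTopology_isTopology : a.tailsTopology.IsTopology :=
  CoverSystem.upglue_isTopology (fun m => ⟨m.deg, le_rfl, fun _ f _ => mem_top f⟩)
    fun h _ hR => a.pullback_mem_tailsSystem h hR

lemma tail_mem_tailsTopology (m : a.Obj) {n : ℤ} (h : m.deg ≤ n) :
    a.tail m n ∈ a.tailsTopology m :=
  .of ⟨n, h, fun _ _ hf => hf⟩

variable {a b}

/-- In a `ℤ`-algebra generated in degree `1`, morphisms factor through all intermediate objects. -/
lemma GeneratedInDegrees.mem_span_comp (ha : a.GeneratedInDegrees {1}) {l n m : ℤ} (h₁ : n ≤ l)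
    (h₂ : m ≤ n) (f : a.hom l m) :
    f ∈ Submodule.span k {h | ∃ (p : a.hom l n) (q : a.hom n m), h = a.comp p q} := by
  obtain ⟨X, hX, hgen⟩ := ha
  have hf : f ∈ Submodule.span k {f : a.hom l m | a.IsProduct X f} := by
    rw [hgen]; trivial
  suffices H : ∀ {l m : ℤ} {f : a.hom l m}, a.IsProduct X f → n ≤ l → m ≤ n →
      f ∈ Submodule.span k {h | ∃ (p : a.hom l n) (q : a.hom n m), h = a.comp p q} from
    Submodule.span_le.2 (fun f hf => H hf h₁ h₂) hf
  clear hf f h₁ h₂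
  intro l m f hf h₁ h₂
  induction hf with
  | one l =>
    obtain rfl : l = n := le_antisymm h₂ h₁
    exact Submodule.subset_span ⟨a.one l, a.one l, (a.one_comp _).symm⟩
  | @comp l l' m f g hf _ ih =>
    have hl : l - l' = 1 := by
      by_contra hne
      rw [hX l l' (by rintro ⟨d, rfl, h⟩; exact hne (by simpa using h))] at hf
      exact hf
    -- The first letter lowers the object by exactly one, so the word either starts at `n` or has
    -- not yet passed it.
    obtain rfl | hn : l = n ∨ n ≤ l' := by omega
    · exact Submodule.subset_span ⟨a.one l, _, (a.one_comp _).symm⟩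
    · have key : Submodule.span k {h | ∃ (p : a.hom l' n) (q : a.hom n m), h = a.comp p q} ≤
          (Submodule.span k {h | ∃ (p : a.hom l n) (q : a.hom n m), h = a.comp p q}).comap
            (a.comp f) := by
        refine Submodule.span_le.2 ?_
        rintro _ ⟨p, q, rfl⟩
        exact Submodule.subset_span ⟨a.comp f p, q, (a.assoc _ _ _).symm⟩
      exact key (ih hn h₂)

/-- The sieve generated by the morphisms from `n` to `m` contains the tail from `n` on. -/
lemma GeneratedInDegrees.tail_le_ofFamily (ha : a.GeneratedInDegrees {1}) {m : a.Obj} {n : ℤ}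
    (h : m.deg ≤ n) :
    a.tail m n ≤ ofFamily k (fun _ : ((⟨n⟩ : a.Obj) ⟶ m) => (⟨n⟩ : a.Obj)) (fun f => f) :=
  tail_le fun l f hl => by
    refine Submodule.span_mono ?_ (ha.mem_span_comp hl h f)
    rintro _ ⟨p, q, rfl⟩
    exact ⟨q, p, rfl⟩

/-- With `N` the maximum of the two coordinates, the tails from `N` on both factors are contained in
the sieves generated by morphisms from `N`; the products of these generators start at the diagonal
object `(N, N)`. -/
lemma imageSieve_diagonalFunctor_mem (ha : a.GeneratedInDegrees {1})
    (hb : b.GeneratedInDegrees {1}) (X : TensorCat k a.Obj b.Obj) :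
    imageSieve (a.diagonalFunctor b) X ∈ tensorTopology a.tailsTopology b.tailsTopology X := by
  have hT := tensorTopology_isTopology a.tailsTopology b.tailsTopology
  refine hT.mem_of_le (box_mem_tensorTopology b.tailsTopology_isTopology
    (a.tail_mem_tailsTopology X.fst (le_max_left X.fst.deg X.snd.deg))
    (b.tail_mem_tailsTopology X.snd (le_max_right X.fst.deg X.snd.deg)))
    (le_trans' (box_mono (ha.tail_le_ofFamily (le_max_left _ _))
      (hb.tail_le_ofFamily (le_max_right _ _))) (box_ofFamily_le fun f g => ?_))
  exact mem_imageSieve (a.diagonalFunctor b) (A := ⟨max X.fst.deg X.snd.deg⟩) (homMk f g)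

lemma map_diagonalFunctor_mem (ha : a.GeneratedInDegrees {1})
    (hb : b.GeneratedInDegrees {1}) {m : (a.diagonal b).Obj} {Q : LinSieve k m}
    (hQ : Q ∈ (a.diagonal b).tailsSystem m) :
    Q.map (a.diagonalFunctor b) ∈
      tensorTopology a.tailsTopology b.tailsTopology ((a.diagonalFunctor b).obj m) := by
  have hT := tensorTopology_isTopology a.tailsTopology b.tailsTopology
  obtain ⟨n, hn, hQ⟩ := hQ
  refine hT.mem_of_le (box_mem_tensorTopology b.tailsTopology_isTopology
    (a.tail_mem_tailsTopology ⟨m.deg⟩ hn) (b.tail_mem_tailsTopology ⟨m.deg⟩ hn))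
    (le_trans' (box_mono (ha.tail_le_ofFamily hn) (hb.tail_le_ofFamily hn))
      (box_ofFamily_le fun f g => ?_))
  exact mem_map (a.diagonalFunctor b) (hQ ⟨n⟩ (mem_tail le_rfl _))

/-- The diagonal functor satisfies (LC). -/
theorem satisfiesLC_diagonalFunctor (ha : a.GeneratedInDegrees {1})
    (hb : b.GeneratedInDegrees {1}) :
    SatisfiesLC (a.diagonal b).tailsTopology (a.diagonalFunctor b)
      (tensorTopology a.tailsTopology b.tailsTopology) := by
  have hc := (a.diagonal b).tailsTopology_isTopology
  have hT := tensorTopology_isTopology a.tailsTopology b.tailsTopology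
  have hco := CoverSystem.coinduced_isTopology (a.diagonalFunctor b) hc
  refine SatisfiesLC.of_sieves hc (imageSieve_diagonalFunctor_mem ha hb) ?_ ?_ (fun m => ?_) ?_
  · exact fun X X' c => hc.mem_of_le (hc.identity X) fun Y f _ => ⟨f ≫ c, rfl⟩
  · intro X X' c hc'
    refine hc.mem_of_le (hc.identity X) fun Y f _ => ?_
    rw [mem_annihilator, show c = 0 from hc', Limits.comp_zero]
  · refine Set.Subset.trans (CoverSystem.upglue_subset
      (CoverSystem.stableInverse_isTopology (a.diagonalFunctor b) hT) (fun m Q hQ m' h => ?_) m)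
      (CoverSystem.stableInverse_subset _ _ m)
    exact map_diagonalFunctor_mem ha hb ((a.diagonal b).pullback_mem_tailsSystem h hQ)
  · refine tensorTopology_subset hco (fun X R hR => ?_) (fun X S hS => ?_)
    · refine box_top_mem_of_upglue hco (fun X R hR l x => ?_) hR
      obtain ⟨n, -, hn⟩ := hR
      -- The bound `n` of the tail in `R` works for the restriction as well; the maximum with
      -- `l.deg` is taken only because a tail on `l` must start at or above `l`.
      refine hc.mem_of_le ((a.diagonal b).tail_mem_tailsTopology l (le_max_right n l.deg))
        (tail_le fun l' f hl' => ?_)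
      rw [mem_restrict]
      -- It suffices to look at an arbitrary morphism from `(l', l')`, decomposed into pure tensors:
      -- the first factors lie in the tail merely because their source does.
      induction (a.diagonalFunctor b).map f ≫ x using hom_induction with
      | zero => exact zero_mem _
      | add x y hx hy => exact add_mem hx hy
      | homMk r g =>
        exact homMk_mem_box
          (hn _ (mem_tail (a := a) (l := ⟨l'.deg⟩) ((le_max_left _ _).trans hl') r))
          (mem_top g)
    · refine top_box_mem_of_upglue hco (fun X R hR l x => ?_) hS
      obtain ⟨n, -, hn⟩ := hR
      refine hc.mem_of_le ((a.diagonal b).tail_mem_tailsTopology l (le_max_right n l.deg))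
        (tail_le fun l' f hl' => ?_)
      rw [mem_restrict]
      induction (a.diagonalFunctor b).map f ≫ x using hom_induction with
      | zero => exact zero_mem _
      | add x y hx hy => exact add_mem hx hy
      | homMk r g =>
        exact homMk_mem_box (mem_top r)
          (hn _ (mem_tail (a := b) (l := ⟨l'.deg⟩) ((le_max_left _ _).trans hl') g))

end ZAlgebra

/-! ### Linear presheaves and gluing -/

section Presheaves

variable {k : Type u} [CommRing k] {C : Type w} [Category.{u} C] [Preadditive C] [Linear k C]

/-- The restriction map of a presheaf of modules along a morphism. -/
def res (F : Cᵒᵖ ⥤ ModuleCat.{u} k) {A B : C} (f : B ⟶ A) :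
    F.obj (op A) →ₗ[k] F.obj (op B) :=
  (F.map f.op).hom

omit [Preadditive C] [Linear k C] in
lemma res_id (F : Cᵒᵖ ⥤ ModuleCat.{u} k) {A : C} (y : F.obj (op A)) : res F (𝟙 A) y = y := by
  simp [res]

omit [Preadditive C] [Linear k C] in
lemma res_comp (F : Cᵒᵖ ⥤ ModuleCat.{u} k) {A B B' : C} (f : B ⟶ A) (g : B' ⟶ B)
    (y : F.obj (op A)) : res F (g ≫ f) y = res F g (res F f y) := by
  simp [res]

omit [Preadditive C] [Linear k C] in
lemma app_res {F G : Cᵒᵖ ⥤ ModuleCat.{u} k} (α : F ⟶ G) {A B : C} (f : B ⟶ A)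
    (y : F.obj (op A)) : (α.app (op B)).hom (res F f y) = res G f ((α.app (op A)).hom y) :=
  congr($(α.naturality f.op).hom y)

/-- `F` is a `C`-module: a `k`-linear functor `Cᵒᵖ ⥤ Mod k`. -/
structure IsLinearPresheaf (F : Cᵒᵖ ⥤ ModuleCat.{u} k) : Prop where
  res_add : ∀ {X Y : C} (f g : X ⟶ Y) (y : F.obj (op Y)), res F (f + g) y = res F f y + res F g y
  res_smul : ∀ {X Y : C} (r : k) (f : X ⟶ Y) (y : F.obj (op Y)), res F (r • f) y = r • res F f y

lemma IsLinearSheaf.isLinearPresheaf {T : CoverSystem k C} {F : Cᵒᵖ ⥤ ModuleCat.{u} k}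
    (hF : IsLinearSheaf T F) : IsLinearPresheaf F where
  res_add f g y := congr($(hF.map_add f g).hom y)
  res_smul r f y := congr($(hF.map_smul r f).hom y)

namespace IsLinearPresheaf

variable {F : Cᵒᵖ ⥤ ModuleCat.{u} k} (hF : IsLinearPresheaf F)
include hF

/-- The linear map `f ↦ y f`. -/
def actₗ {A : C} (y : F.obj (op A)) (B : C) : (B ⟶ A) →ₗ[k] F.obj (op B) where
  toFun f := res F f y
  map_add' f g := hF.res_add f g y
  map_smul' r f := hF.res_smul r f y

lemma res_zero {A B : C} (y : F.obj (op A)) : res F (0 : B ⟶ A) y = 0 :=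
  map_zero (hF.actₗ y B)

/-- The sieve of all `f` with `y f = 0`. -/
def annihilator {A : C} (y : F.obj (op A)) : LinSieve k A where
  arrows B := LinearMap.ker (hF.actₗ y B)
  comp_mem g f hf := by
    change res F (g ≫ f) y = 0
    rw [res_comp, show res F f y = 0 from hf, map_zero]

lemma mem_annihilator {A : C} {y : F.obj (op A)} {B : C} {f : B ⟶ A} :
    f ∈ (hF.annihilator y).arrows B ↔ res F f y = 0 := Iff.rfl

lemma isLinearSheaf {T : CoverSystem k C} (h : ∀ A, ∀ R ∈ T A, IsSheafForSieve F R) :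
    IsLinearSheaf T F where
  map_add f g := by ext y; exact hF.res_add f g y
  map_smul r f := by ext y; exact hF.res_smul r f y
  isSheaf := h

end IsLinearPresheaf

namespace IsLinearSheaf

variable {T : CoverSystem k C} {F : Cᵒᵖ ⥤ ModuleCat.{u} k} (hF : IsLinearSheaf T F)
include hF

/-- Both `y` and `0` amalgamate the zero family on the annihilator. -/
lemma eq_zero {A : C} {y : F.obj (op A)} (h : hF.isLinearPresheaf.annihilator y ∈ T A) :
    y = 0 := by
  refine (hF.isSheaf A _ h (fun _ => 0) (fun B B' g f => (map_zero _).symm)).unique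
    (fun B f => f.2) (fun B f => map_zero (res F f.1))

lemma ext_of_cover (hT : T.IsTopology) {A : C} {R : LinSieve k A} (hR : R ∈ T A)
    {y y' : F.obj (op A)}
    (h : ∀ (B : C) (f : B ⟶ A), f ∈ R.arrows B → res F f y = res F f y') : y = y' := by
  rw [← sub_eq_zero]
  refine hF.eq_zero (hT.mem_of_le hR fun B f hf => ?_)
  rw [IsLinearPresheaf.mem_annihilator, map_sub, h B f hf, sub_self]

/-- Glueing along a functional relation. -/
lemma glue (hT : T.IsTopology) {A : C} (ρ : ∀ B : C, Submodule k ((B ⟶ A) × F.obj (op B)))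
    (hρ : ∀ {B B' : C} (g : B' ⟶ B) {f : B ⟶ A} {z : F.obj (op B)},
      (f, z) ∈ ρ B → (g ≫ f, res F g z) ∈ ρ B')
    {R : LinSieve k A} (hR : R ∈ T A)
    (hdom : ∀ (B : C) (f : B ⟶ A), f ∈ R.arrows B → ∃ z, (f, z) ∈ ρ B)
    (hfun : ∀ (B : C) (z : F.obj (op B)), ((0 : B ⟶ A), z) ∈ ρ B → z = 0) :
    ∃ y : F.obj (op A), ∀ (B : C) (f : B ⟶ A) (z : F.obj (op B)), (f, z) ∈ ρ B → res F f y = z := by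
  -- By linearity, single-valuedness over `0` gives it everywhere. A relation replaces a function so
  -- that values can be described through non-unique lifts.
  have huniq : ∀ {B : C} {f : B ⟶ A} {z z' : F.obj (op B)}, (f, z) ∈ ρ B → (f, z') ∈ ρ B →
      z = z' := fun {B f z z'} h h' => by
    rw [← sub_eq_zero]
    refine hfun B _ ?_
    simpa using sub_mem h h'
  choose z hz using hdom
  let x : ∀ B : C, R.arrows B →ₗ[k] F.obj (op B) := fun B =>
    { toFun := fun f => z B f.1 f.2
      map_add' := fun f g => huniq (hz B _ _) (add_mem (hz B _ f.2) (hz B _ g.2))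
      map_smul' := fun r f => huniq (hz B _ _) (Submodule.smul_mem _ r (hz B _ f.2)) }
  obtain ⟨y, hy, -⟩ := hF.isSheaf A R hR x fun B B' g f =>
    huniq (hz B' _ _) (hρ g (hz B _ f.2))
  -- The related pairs whose first entry is outside `R` are covered too: compare after restricting
  -- to `f⁻¹ R`.
  refine ⟨y, fun B f w hw => hF.ext_of_cover hT (hT.pullback f hR) fun B' g hg => ?_⟩
  rw [← res_comp]
  exact (hy B' ⟨g ≫ f, hg⟩).trans (huniq (hz B' _ _) (hρ g hw))

end IsLinearSheaf

end Presheaves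

/-! ### Restriction of sheaves along an (LC) functor -/

section Comparison

variable {k : Type u} [CommRing k]
  {A : Type w₁} [Category.{u} A] [Preadditive A] [Linear k A]
  {C : Type w₂} [Category.{u} C] [Preadditive C] [Linear k C]
  {φ : A ⥤ C} [φ.Additive] [φ.Linear k] {TA : CoverSystem k A} {TC : CoverSystem k C}
  (hTA : TA.IsTopology) (hTC : TC.IsTopology) (hφ : SatisfiesLC TA φ TC)

lemma IsLinearPresheaf.restrict {G : Cᵒᵖ ⥤ ModuleCat.{u} k} (hG : IsLinearPresheaf G) :
    IsLinearPresheaf (φ.op ⋙ G) where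
  res_add f g y := by
    change res G (φ.map (f + g)) y = res G (φ.map f) y + res G (φ.map g) y
    rw [φ.map_add, hG.res_add]
  res_smul r f y := by
    change res G (φ.map (r • f)) y = r • res G (φ.map f) y
    rw [φ.map_smul, hG.res_smul]

include hTC hφ

/-- By (G) the morphisms from image objects generate a cover, so a section is determined by its
restrictions along them. -/
lemma IsLinearSheaf.ext_of_image {G : Cᵒᵖ ⥤ ModuleCat.{u} k} (hG : IsLinearSheaf TC G)
    {X : C} {y y' : G.obj (op X)}
    (h : ∀ (B : A) (x : φ.obj B ⟶ X), res G x y = res G x y') : y = y' := by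
  rw [← sub_eq_zero]
  refine hG.eq_zero (hTC.mem_of_le (hφ.generating.imageSieve_mem hTC X)
    (imageSieve_le φ fun B x => ?_))
  rw [IsLinearPresheaf.mem_annihilator, map_sub, h B x, sub_self]

include hTA

/-- Glueing along a functional relation that is only given on objects in the image of `φ`. -/
lemma IsLinearSheaf.glue_image {G : Cᵒᵖ ⥤ ModuleCat.{u} k} (hG : IsLinearSheaf TC G) {X : C}
    (σ : ∀ B : A, Submodule k ((φ.obj B ⟶ X) × G.obj (op (φ.obj B))))
    (hσ : ∀ {B B' : A} (b : B' ⟶ B) {x : φ.obj B ⟶ X} {z : G.obj (op (φ.obj B))},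
      (x, z) ∈ σ B → (φ.map b ≫ x, res G (φ.map b) z) ∈ σ B')
    (hdom : ofFamily k (ι := Σ B : A, σ B) (fun i => φ.obj i.1) (fun i => i.2.1.1) ∈ TC X)
    (hfun : ∀ (B : A) (z : G.obj (op (φ.obj B))), ((0 : φ.obj B ⟶ X), z) ∈ σ B → z = 0) :
    ∃ y : G.obj (op X), ∀ (B : A) (x : φ.obj B ⟶ X) (z : G.obj (op (φ.obj B))),
      (x, z) ∈ σ B → res G x y = z := by
  -- The relation is extended to all objects by precomposition and linear span.
  let s : ∀ Z : C, Set ((Z ⟶ X) × G.obj (op Z)) := fun Z =>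
    {p | ∃ (B : A) (g : Z ⟶ φ.obj B) (q : (φ.obj B ⟶ X) × G.obj (op (φ.obj B))), q ∈ σ B ∧
      p = (g ≫ q.1, res G g q.2)}
  -- By (F), an element of the extended relation, viewed from an image object, lies locally in `σ`.
  -- Hence single-valuedness of `σ` is inherited by the extension.
  have hs : ∀ {Z : C} {p : (Z ⟶ X) × G.obj (op Z)}, p ∈ Submodule.span k (s Z) →
      ∀ (B : A) (v : φ.obj B ⟶ Z), ∃ R ∈ TA B, ∀ (B' : A) (b : B' ⟶ B), b ∈ R.arrows B' →
        (φ.map b ≫ v ≫ p.1, res G (φ.map b) (res G v p.2)) ∈ σ B' := by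
    intro Z p hp B v
    induction hp using Submodule.span_induction with
    | mem p hp =>
      obtain ⟨B₀, g, q, hq, rfl⟩ := hp
      refine ⟨_, hφ.full.liftSieve_mem hTA (v ≫ g), fun B' b hb => ?_⟩
      obtain ⟨f, hf⟩ := (mem_liftSieve φ).1 hb
      have := hσ f hq
      simp only [hf, res_comp, Category.assoc] at this
      exact this
    | zero =>
      refine ⟨⊤, hTA.identity B, fun B' b _ => ?_⟩
      simp only [Prod.fst_zero, Prod.snd_zero, Limits.comp_zero, map_zero]
      exact zero_mem (σ B')
    | add p q _ _ hp hq =>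
      obtain ⟨R, hR, hR'⟩ := hp
      obtain ⟨S, hS, hS'⟩ := hq
      refine ⟨_, hTA.inter_mem hR hS, fun B' b hb => ?_⟩
      simpa using add_mem (hR' B' b hb.1) (hS' B' b hb.2)
    | smul r p _ hp =>
      obtain ⟨R, hR, hR'⟩ := hp
      refine ⟨R, hR, fun B' b hb => ?_⟩
      simpa using Submodule.smul_mem _ r (hR' B' b hb)
  refine Exists.imp (fun y hy => ?_) (hG.glue hTC (fun Z => Submodule.span k (s Z))
    (fun {Z Z'} g f z hz => ?_) hdom (fun Z f hf => ?_) (fun Z z hz => ?_))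
  · exact fun B x z hz => hy _ x z (Submodule.subset_span ⟨B, 𝟙 _, _, hz, by simp [res_id]⟩)
  · have key : Submodule.span k (s Z) ≤ (Submodule.span k (s Z')).comap
        ((Linear.leftComp k X g).prodMap (res G g)) := by
      refine Submodule.span_le.2 ?_
      rintro _ ⟨B, h, q, hq, rfl⟩
      exact Submodule.subset_span ⟨B, g ≫ h, q, hq, by simp [res_comp]⟩
    exact key hz
  · change f ∈ Submodule.span k _ at hf
    induction hf using Submodule.span_induction with
    | mem f hf =>
      obtain ⟨⟨B, q, hq⟩, g, rfl⟩ := hf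
      exact ⟨_, Submodule.subset_span ⟨B, g, q, hq, rfl⟩⟩
    | zero => exact ⟨0, zero_mem _⟩
    | add _ _ _ _ h h' =>
      obtain ⟨z, hz⟩ := h
      obtain ⟨z', hz'⟩ := h'
      exact ⟨z + z', add_mem hz hz'⟩
    | smul r _ _ h =>
      obtain ⟨z, hz⟩ := h
      exact ⟨r • z, Submodule.smul_mem _ r hz⟩
  · refine hG.ext_of_image hTC hφ fun B v => ?_
    obtain ⟨R, hR, hR'⟩ := hs hz B v
    refine hG.ext_of_cover hTC (hφ.map_mem hR) (fun Z f hf => ?_)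
    rw [← sub_eq_zero, ← map_sub]
    refine map_le φ (S := hG.isLinearPresheaf.annihilator _) (fun B' b hb => ?_) Z hf
    rw [IsLinearPresheaf.mem_annihilator, map_zero, sub_zero]
    refine hfun B' _ ?_
    simpa using hR' B' b hb

/-- A matching family `x` on `R` is glued over the cover `φ R` through the relation formed by the
pairs `(φ f, x f)`. It is single-valued by (FF): if `φ f = 0`, then `f` is locally zero, hence so is
`x f`, and `G` is separated for images of covers. -/
lemma IsLinearSheaf.restrict {G : Cᵒᵖ ⥤ ModuleCat.{u} k} (hG : IsLinearSheaf TC G) :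
    IsLinearSheaf TA (φ.op ⋙ G) := by
  refine (hG.isLinearPresheaf.restrict (φ := φ)).isLinearSheaf fun X R hR x hx => ?_
  have hx' : ∀ (B B' : A) (g : B' ⟶ B) (f : R.arrows B),
      x B' ⟨g ≫ f.1, R.comp_mem g f.2⟩ = res G (φ.map g) (x B f) := hx
  have hsep : ∀ {Y : A} {S : LinSieve k Y} (_ : S ∈ TA Y) {y y' : G.obj (op (φ.obj Y))}
      (_ : ∀ (B : A) (f : B ⟶ Y), f ∈ S.arrows B → res G (φ.map f) y = res G (φ.map f) y'),
      y = y' := fun {Y S} hS {y y'} h => by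
    rw [← sub_eq_zero]
    refine hG.eq_zero (hTC.mem_of_le (hφ.map_mem hS) (map_le φ fun B f hf => ?_))
    rw [IsLinearPresheaf.mem_annihilator, map_sub, h B f hf, sub_self]
  refine Exists.imp (fun y hy => ?_) (hG.glue_image hTA hTC hφ (X := φ.obj X)
    (fun B => LinearMap.range (((φ.mapLinearMap k) ∘ₗ (R.arrows B).subtype).prod (x B)))
    (fun {B B'} b {f z} hf => ?_) (hTC.mem_of_le (hφ.map_mem hR) (map_le φ fun B f hf => ?_))
    (fun B z hz => ?_))
  · refine ⟨fun B f => hy B _ _ ⟨f, rfl⟩, fun y' hy' => ?_⟩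
    exact hsep hR fun B f hf => (hy' B ⟨f, hf⟩).trans (hy B _ _ ⟨⟨f, hf⟩, rfl⟩).symm
  · obtain ⟨r, hr⟩ := hf
    obtain ⟨rfl, rfl⟩ := Prod.ext_iff.1 hr
    refine ⟨⟨b ≫ r.1, R.comp_mem b r.2⟩, Prod.ext (φ.map_comp _ _) (hx' _ _ _ _)⟩
  · exact mem_ofFamily_self (k := k) (ι := Σ B : A, LinearMap.range
      (((φ.mapLinearMap k) ∘ₗ (R.arrows B).subtype).prod (x B))) (X := fun i => φ.obj i.1)
      (f := fun i => i.2.1.1) ⟨B, ⟨_, ⟨⟨f, hf⟩, rfl⟩⟩⟩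
  · obtain ⟨r, hr⟩ := hz
    obtain ⟨h0, rfl⟩ := Prod.ext_iff.1 hr
    refine hsep (hφ.faithful.annihilator_mem hTA (b := r.1) h0) fun B' b hb => ?_
    have hb0 : (⟨b ≫ r.1, R.comp_mem b r.2⟩ : R.arrows B') = 0 := Subtype.ext hb
    rw [map_zero]
    exact (hx' _ _ _ _).symm.trans (by rw [hb0, map_zero])

/-- Restriction of sheaves along an (LC) functor. -/
def restrictSheaf : Sh TC ⥤ Sh TA where
  obj G := ⟨φ.op ⋙ G.obj, G.property.restrict hTA hTC hφ⟩
  map α := ObjectProperty.homMk (Functor.whiskerLeft φ.op α.hom)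

omit hTA hTC hφ

instance : (restrictSheaf hTA hTC hφ).Additive where

instance : (restrictSheaf hTA hTC hφ).Linear k where

instance : (restrictSheaf hTA hTC hφ).Faithful where
  map_injective {F G} α β h := by
    ext ⟨X⟩ s
    refine G.property.ext_of_image hTC hφ fun B x => ?_
    have h' : α.hom.app (op (φ.obj B)) = β.hom.app (op (φ.obj B)) :=
      congr_app (congr_arg (fun γ => γ.hom) h) (op B)
    change res _ x ((α.hom.app (op X)).hom s) = res _ x ((β.hom.app (op X)).hom s)
    rw [← app_res, ← app_res, h']

/-- The image of `s` must restrict along each `x : φ B ⟶ X` to `α` applied to the restriction of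
`s`. These values glue over the cover supplied by (G), and uniqueness makes the result linear and
natural. -/
instance : (restrictSheaf hTA hTC hφ).Full where
  map_surjective {F G} α := by
    have hF := F.property.isLinearPresheaf
    have hα : ∀ {B B' : A} (b : B' ⟶ B) (s : F.obj.obj (op (φ.obj B))),
        (α.hom.app (op B')).hom (res F.obj (φ.map b) s) =
          res G.obj (φ.map b) ((α.hom.app (op B)).hom s) := fun b s => app_res α.hom b s
    have key : ∀ (X : C) (s : F.obj.obj (op X)), ∃ t : G.obj.obj (op X),
        ∀ (B : A) (x : φ.obj B ⟶ X), res G.obj x t = (α.hom.app (op B)).hom (res F.obj x s) := by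
      intro X s
      refine Exists.imp (fun t ht => ?_) (G.property.glue_image hTA hTC hφ (X := X)
        (fun B => LinearMap.graph ((α.hom.app (op B)).hom ∘ₗ hF.actₗ s (φ.obj B)))
        (fun {B B'} b {x z} hz => ?_)
        (hTC.mem_of_le (hφ.generating.imageSieve_mem hTC X) (imageSieve_le φ fun B x => ?_))
        (fun B z hz => ?_))
      · exact fun B x => ht B x _ ((LinearMap.mem_graph_iff _ _).2 rfl)
      · rw [LinearMap.mem_graph_iff] at hz ⊢
        change z = (α.hom.app (op B)).hom (res F.obj x s) at hz
        change _ = (α.hom.app (op B')).hom (res F.obj (φ.map b ≫ x) s)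
        rw [res_comp, hα, hz]
      · exact mem_ofFamily_self (k := k) (ι := Σ B : A, LinearMap.graph
          ((α.hom.app (op B)).hom ∘ₗ hF.actₗ s (φ.obj B))) (X := fun i => φ.obj i.1)
          (f := fun i => i.2.1.1) ⟨B, ⟨(x, (α.hom.app (op B)).hom (res F.obj x s)),
            (LinearMap.mem_graph_iff _ _).2 rfl⟩⟩
      · rw [LinearMap.mem_graph_iff] at hz
        exact hz.trans (map_zero _)
    choose t ht using key
    let β : F.obj ⟶ G.obj :=
      { app := fun X => ModuleCat.ofHom
          { toFun := fun s => t X.unop s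
            map_add' := fun s s' => G.property.ext_of_image hTC hφ fun B x => by
              simp only [map_add, ht]
              exact map_add _ _ _
            map_smul' := fun r s => G.property.ext_of_image hTC hφ fun B x => by
              simp only [map_smul, ht, RingHom.id_apply]
              exact map_smul _ _ _ }
        naturality := fun X Y f => by
          ext s
          refine G.property.ext_of_image hTC hφ fun B x => ?_
          change res _ x (t Y.unop (res F.obj f.unop s)) = res _ x (res G.obj f.unop (t X.unop s))
          rw [ht, ← res_comp, ← res_comp, ht] }
    refine ⟨ObjectProperty.homMk β, ?_⟩
    ext ⟨B⟩ s
    change t (φ.obj B) s = (α.hom.app (op B)).hom s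
    have h := ht (φ.obj B) s B (𝟙 _)
    rw [res_id] at h
    exact h.trans (congr_arg _ (res_id F.obj (A := φ.obj B) s))

end Comparison

/-! ### The comparison theorem -/

section Coextension

variable {k : Type u} [CommRing k]
  {A : Type u} [Category.{u} A] [Preadditive A] [Linear k A]
  {C : Type w₂} [Category.{u} C] [Preadditive C] [Linear k C]
  (φ : A ⥤ C) (F : Aᵒᵖ ⥤ ModuleCat.{u} k)

/-- The module of `A`-linear maps `C(φ -, X) ⟶ F`. -/
def coextObj (X : C) : Submodule k (∀ B : A, (φ.obj B ⟶ X) →ₗ[k] F.obj (op B)) where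
  carrier := {t | ∀ (B B' : A) (b : B' ⟶ B) (x : φ.obj B ⟶ X),
    t B' (φ.map b ≫ x) = res F b (t B x)}
  zero_mem' _ _ _ _ := (map_zero _).symm
  add_mem' ht ht' B B' b x := by simp [ht B B' b x, ht' B B' b x]
  smul_mem' r t ht B B' b x := by simp [ht B B' b x]

variable {φ F} in
lemma coextObj_comp {X : C} (t : coextObj φ F X) {B B' : A} (b : B' ⟶ B) (x : φ.obj B ⟶ X) :
    t.1 B' (φ.map b ≫ x) = res F b (t.1 B x) := t.2 B B' b x

/-- The functoriality of `coextObj`. -/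
def coextMap {X X' : C} (g : X' ⟶ X) : coextObj φ F X →ₗ[k] coextObj φ F X' where
  toFun t := ⟨fun B => t.1 B ∘ₗ (Linear.rightComp k (φ.obj B) g), fun B B' b x => by
    simp [coextObj_comp]⟩
  map_add' _ _ := rfl
  map_smul' _ _ := rfl

/-- The coextension of `F` along `φ`. -/
def coext : Cᵒᵖ ⥤ ModuleCat.{u} k where
  obj X := ModuleCat.of k (coextObj φ F X.unop)
  map g := ModuleCat.ofHom (coextMap φ F g.unop)
  map_id X := ModuleCat.hom_ext <| LinearMap.ext fun t =>
    Subtype.ext <| funext fun B => LinearMap.ext fun x => by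
      change t.1 B (x ≫ 𝟙 _) = t.1 B x
      rw [Category.comp_id]
  map_comp {X Y Z} f g := ModuleCat.hom_ext <| LinearMap.ext fun t =>
    Subtype.ext <| funext fun B => LinearMap.ext fun x => by
      change t.1 B (x ≫ g.unop ≫ f.unop) = t.1 B ((x ≫ g.unop) ≫ f.unop)
      rw [Category.assoc]

lemma coext_isLinearPresheaf : IsLinearPresheaf (coext φ F) where
  res_add f g t := by
    refine Subtype.ext (funext fun B => LinearMap.ext fun x => ?_)
    change t.1 B (x ≫ (f + g)) = t.1 B (x ≫ f) + t.1 B (x ≫ g)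
    rw [Preadditive.comp_add, map_add]
  res_smul r f t := by
    refine Subtype.ext (funext fun B => LinearMap.ext fun x => ?_)
    change t.1 B (x ≫ (r • f)) = r • t.1 B (x ≫ f)
    rw [Linear.comp_smul, map_smul]

/-- Evaluation at the identity. -/
def coextEval (B : A) : coextObj φ F (φ.obj B) →ₗ[k] F.obj (op B) where
  toFun t := t.1 B (𝟙 _)
  map_add' _ _ := rfl
  map_smul' _ _ := rfl

lemma coextEval_coextMap {X : C} (t : coextObj φ F X) {B : A} (x : φ.obj B ⟶ X) :
    coextEval φ F B (coextMap φ F x t) = t.1 B x := by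
  change t.1 B (𝟙 _ ≫ x) = _
  rw [Category.id_comp]

lemma coextEval_naturality {B B' : A} (b : B' ⟶ B) (t : coextObj φ F (φ.obj B)) :
    coextEval φ F B' (coextMap φ F (φ.map b) t) = res F b (coextEval φ F B t) := by
  rw [coextEval_coextMap]
  change _ = res F b (t.1 B (𝟙 _))
  rw [← coextObj_comp, Category.comp_id]

variable {φ F} [φ.Additive] [φ.Linear k] {TA : CoverSystem k A} {TC : CoverSystem k C}
  (hTA : TA.IsTopology) (hTC : TC.IsTopology) (hφ : SatisfiesLC TA φ TC)
include hTA hTC hφ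

/-- The value of the glued map at `v : φ B ⟶ X` is glued in `F` over the restriction of `R` along
`v`, a cover of `B` by `restrict_mem`, from the values forced there by `x`. -/
lemma existsUnique_coextObj (hF : IsLinearSheaf TA F) {X : C} {R : LinSieve k X} (hR : R ∈ TC X)
    (x : ∀ Z : C, R.arrows Z →ₗ[k] coextObj φ F Z)
    (hx : ∀ {Z Z' : C} (g : Z' ⟶ Z) (f : R.arrows Z),
      x Z' ⟨g ≫ f.1, R.comp_mem g f.2⟩ = coextMap φ F g (x Z f)) :
    ∃! t : coextObj φ F X, ∀ (Z : C) (f : R.arrows Z), coextMap φ F f.1 t = x Z f := by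
  have hr : ∀ {B : A} (v : φ.obj B ⟶ X), R.restrict φ v ∈ TA B :=
    fun v => hφ.restrict_mem hTA hTC hR v
  have key : ∀ (B : A) (v : φ.obj B ⟶ X), ∃ y : F.obj (op B), ∀ (B' : A) (a : B' ⟶ B)
      (ha : φ.map a ≫ v ∈ R.arrows (φ.obj B')),
      res F a y = coextEval φ F B' (x _ ⟨φ.map a ≫ v, ha⟩) := by
    intro B v
    obtain ⟨y, hy, -⟩ := hF.isSheaf B _ (hr v) (fun B' => coextEval φ F B' ∘ₗ x (φ.obj B') ∘ₗ
      ((Linear.rightComp k (φ.obj B') v ∘ₗ φ.mapLinearMap k).restrict fun a ha => ha))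
      (fun B' B'' b a => by
        have h₁ : (⟨φ.map (b ≫ a.1) ≫ v,
            (mem_restrict φ).1 ((R.restrict φ v).comp_mem b a.2)⟩ : R.arrows (φ.obj B'')) =
            ⟨φ.map b ≫ φ.map a.1 ≫ v, R.comp_mem _ ((mem_restrict φ).1 a.2)⟩ :=
              Subtype.ext (by simp)
        change coextEval φ F B'' (x _ ⟨φ.map (b ≫ a.1) ≫ v, _⟩) =
          res F b (coextEval φ F B' (x _ ⟨φ.map a.1 ≫ v, _⟩))
        rw [h₁, hx (φ.map b) ⟨φ.map a.1 ≫ v, (mem_restrict φ).1 a.2⟩, coextEval_naturality])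
    exact ⟨y, fun B' a ha => hy B' ⟨a, ha⟩⟩
  choose t ht using key
  let t' : coextObj φ F X := ⟨fun B =>
    { toFun := t B
      map_add' := fun v v' => hF.ext_of_cover hTA (hTA.inter_mem (hr v) (hr v'))
        fun B' a ha => by
          have h₁ : φ.map a ≫ (v + v') = φ.map a ≫ v + φ.map a ≫ v' :=
            Preadditive.comp_add _ _ _ _ _ _
          have h₂ : φ.map a ≫ (v + v') ∈ R.arrows (φ.obj B') := h₁ ▸ add_mem ha.1 ha.2
          rw [map_add, ht B v _ _ ha.1, ht B v' _ _ ha.2, ht B _ _ _ h₂, ← map_add, ← map_add]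
          exact congr_arg _ (congr_arg _ (Subtype.ext h₁))
      map_smul' := fun r v => hF.ext_of_cover hTA (hr v) fun B' a ha => by
        have h₁ : φ.map a ≫ (r • v) = r • φ.map a ≫ v := Linear.comp_smul _ _ _ _ _ _
        have h₂ : φ.map a ≫ (r • v) ∈ R.arrows (φ.obj B') := h₁ ▸ Submodule.smul_mem _ r ha
        rw [RingHom.id_apply, map_smul, ht B v _ _ ha, ht B _ _ _ h₂, ← map_smul, ← map_smul]
        exact congr_arg _ (congr_arg _ (Subtype.ext h₁)) }, fun B B' b v => by
      refine hF.ext_of_cover hTA (hr (φ.map b ≫ v)) fun B'' a ha => ?_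
      have h₂ : φ.map (a ≫ b) ≫ v ∈ R.arrows (φ.obj B'') := by
        simpa using (mem_restrict φ).1 ha
      change res F a (t B' (φ.map b ≫ v)) = res F a (res F b (t B v))
      rw [← res_comp, ht B' _ _ _ ha, ht B _ _ _ h₂]
      exact congr_arg _ (congr_arg _ (Subtype.ext (by simp)))⟩
  refine ⟨t', fun Z f => ?_, fun t'' ht'' => ?_⟩
  · refine Subtype.ext (funext fun B => LinearMap.ext fun v => ?_)
    change t B (v ≫ f.1) = (x Z f).1 B v
    have h₂ : φ.map (𝟙 B) ≫ v ≫ f.1 ∈ R.arrows (φ.obj B) := by simpa using R.comp_mem v f.2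
    have := ht B (v ≫ f.1) B (𝟙 B) h₂
    rw [res_id] at this
    rw [this, ← coextEval_coextMap, ← hx v f]
    exact congr_arg _ (congr_arg _ (Subtype.ext (by simp)))
  · refine Subtype.ext (funext fun B => LinearMap.ext fun v => ?_)
    refine hF.ext_of_cover hTA (hr v) fun B' a ha => ?_
    change _ = res F a (t B v)
    rw [ht B v _ _ ha, ← coextObj_comp, ← ht'' _ ⟨φ.map a ≫ v, ha⟩]
    exact (coextEval_coextMap φ F t'' (φ.map a ≫ v)).symm

lemma coext_isLinearSheaf (hF : IsLinearSheaf TA F) : IsLinearSheaf TC (coext φ F) :=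
  (coext_isLinearPresheaf φ F).isLinearSheaf fun _ _ hR x hx =>
    existsUnique_coextObj hTA hTC hφ hF hR x fun g f => hx _ _ g f

omit hTC in
-- By (F), every `x : φ B' ⟶ φ B` is locally `φ f`, so `t` is determined by `t (φ f) = (t 1) f`.
-- Conversely, this formula defines a `t` for every prescribed value at the identity, because (FF)
-- makes it independent of `f`.
lemma coextEval_bijective (hF : IsLinearSheaf TA F) (B : A) :
    Function.Bijective (coextEval φ F B) := by
  have hl := hF.isLinearPresheaf
  refine ⟨(injective_iff_map_eq_zero _).2 fun t ht => ?_, fun s => ?_⟩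
  · refine Subtype.ext (funext fun B' => LinearMap.ext fun x => ?_)
    refine hF.ext_of_cover hTA (hφ.full.liftSieve_mem hTA x) fun B'' b hb => ?_
    obtain ⟨f, hf⟩ := (mem_liftSieve φ).1 hb
    rw [← coextObj_comp, ← hf, ← Category.comp_id (φ.map f), coextObj_comp]
    refine (congr_arg (res F f) ht).trans ?_
    rw [map_zero]
    exact (map_zero _).symm
  · have h0 : ∀ {B' : A} {f : B' ⟶ B}, φ.map f = 0 → res F f s = 0 := fun {B' f} hf =>
      hF.ext_of_cover hTA (hφ.faithful.annihilator_mem hTA hf) fun B'' b hb => by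
        rw [← res_comp, mem_annihilator.1 hb, hl.res_zero, map_zero]
    have key : ∀ (B' : A) (x : φ.obj B' ⟶ φ.obj B), ∃ z : F.obj (op B'),
        ∀ (B'' : A) (b : B'' ⟶ B') (f : B'' ⟶ B), φ.map f = φ.map b ≫ x →
          res F b z = res F f s := by
      intro B' x
      -- The relation consists of the pairs `(b, s f)` with `φ f = φ b ≫ x`, the image of an
      -- equalizer, so no lift `f` has to be chosen.
      refine Exists.imp (fun z hz => ?_) (hF.glue hTA (A := B') (fun B'' =>
        (LinearMap.eqLocus (φ.mapLinearMap k ∘ₗ LinearMap.fst k (B'' ⟶ B) (B'' ⟶ B'))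
          (Linear.rightComp k (φ.obj B'') x ∘ₗ φ.mapLinearMap k ∘ₗ LinearMap.snd k _ _)).map
          ((LinearMap.snd k _ _).prod (hl.actₗ s B'' ∘ₗ LinearMap.fst k _ _)))
        (fun {B₁ B₂} g {f z} h => ?_) (hφ.full.liftSieve_mem hTA x) (fun B'' b hb => ?_)
        (fun B'' z hz => ?_))
      · exact fun B'' b f h => hz B'' b _ ⟨(f, b), h, rfl⟩
      · obtain ⟨⟨f', b⟩, h, hf⟩ := h
        obtain ⟨rfl, rfl⟩ := Prod.ext_iff.1 hf
        refine ⟨(g ≫ f', g ≫ b), ?_, Prod.ext rfl (res_comp F f' g s)⟩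
        change φ.map f' = φ.map b ≫ x at h
        change φ.map (g ≫ f') = φ.map (g ≫ b) ≫ x
        simp [h]
      · obtain ⟨f, hf⟩ := (mem_liftSieve φ).1 hb
        exact ⟨_, ⟨(f, b), hf, rfl⟩⟩
      · obtain ⟨⟨f', b⟩, h, hf⟩ := hz
        obtain ⟨hb, hf'⟩ := Prod.ext_iff.1 hf
        change b = 0 at hb
        change res F f' s = z at hf'
        change φ.map f' = φ.map b ≫ x at h
        rw [← hf']
        exact h0 (by rw [h, hb, φ.map_zero, Limits.zero_comp])
    choose z hz using key
    have hlift : ∀ {B' : A} (x : φ.obj B' ⟶ φ.obj B), liftSieve φ x ∈ TA B' :=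
      fun x => hφ.full.liftSieve_mem hTA x
    refine ⟨⟨fun B' =>
      { toFun := z B'
        map_add' := fun x x' => hF.ext_of_cover hTA (hTA.inter_mem (hlift x) (hlift x'))
          fun B'' b hb => ?_
        map_smul' := fun r x => hF.ext_of_cover hTA (hlift x) fun B'' b hb => ?_ },
      fun B₁ B₂ b x => hF.ext_of_cover hTA (hlift (φ.map b ≫ x)) fun B₃ b' hb' => ?_⟩, ?_⟩
    · obtain ⟨f, hf⟩ := (mem_liftSieve φ).1 hb.1
      obtain ⟨f', hf'⟩ := (mem_liftSieve φ).1 hb.2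
      rw [map_add, hz B' x B'' b f hf, hz B' x' B'' b f' hf', hz B' _ B'' b (f + f')
        (by rw [φ.map_add, hf, hf', Preadditive.comp_add]), hl.res_add]
    · obtain ⟨f, hf⟩ := (mem_liftSieve φ).1 hb
      rw [RingHom.id_apply, map_smul, hz B' x B'' b f hf, hz B' _ B'' b (r • f)
        (by rw [φ.map_smul, hf, Linear.comp_smul]), hl.res_smul]
    · obtain ⟨f, hf⟩ := (mem_liftSieve φ).1 hb'
      change res F b' (z B₂ (φ.map b ≫ x)) = res F b' (res F b (z B₁ x))
      rw [← res_comp, hz _ _ _ b' f hf, hz _ _ _ (b' ≫ b) f (by simpa using hf)]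
    · change z B (𝟙 _) = s
      have := hz B (𝟙 _) B (𝟙 _) (𝟙 _) (by simp)
      rwa [res_id, res_id] at this

omit hTC in
/-- The counit of the adjunction between restriction and coextension is an isomorphism. -/
lemma nonempty_restrict_coext_iso (hF : IsLinearSheaf TA F) :
    Nonempty (φ.op ⋙ coext φ F ≅ F) :=
  ⟨NatIso.ofComponents (fun B => (LinearEquiv.ofBijective (coextEval φ F B.unop)
    (coextEval_bijective hTA hφ hF B.unop)).toModuleIso) fun b =>
      ModuleCat.hom_ext <| LinearMap.ext fun t => coextEval_naturality φ F b.unop t⟩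

omit hTA hTC hφ

instance : (restrictSheaf hTA hTC hφ).EssSurj where
  mem_essImage F := by
    obtain ⟨e⟩ := nonempty_restrict_coext_iso hTA hφ F.property
    exact ⟨⟨coext φ F.obj, coext_isLinearSheaf hTA hTC hφ F.property⟩,
      ⟨ObjectProperty.isoMk _ e⟩⟩

include hTA hTC hφ in
/-- The comparison theorem: an (LC) functor induces an equivalence between categories of
sheaves. -/
theorem SatisfiesLC.linearEquivalent : LinearEquivalent k (Sh TC) (Sh TA) := by
  have : (restrictSheaf hTA hTC hφ).IsEquivalence := { }
  exact ⟨(restrictSheaf hTA hTC hφ).asEquivalence,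
    inferInstanceAs (restrictSheaf hTA hTC hφ).Additive,
    inferInstanceAs ((restrictSheaf hTA hTC hφ).Linear k)⟩

end Coextension

/-! ### Symmetry and transitivity of linear equivalence -/

section LinearEquivalent

variable {k : Type u} [CommRing k]
  {C : Type*} [Category C] [Preadditive C] [Linear k C]
  {D : Type*} [Category D] [Preadditive D] [Linear k D]
  {E : Type*} [Category E] [Preadditive E] [Linear k E]

lemma LinearEquivalent.symm (h : LinearEquivalent k C D) : LinearEquivalent k D C := by
  obtain ⟨e, _, _⟩ := h
  exact ⟨e.symm, inferInstanceAs e.inverse.Additive, inferInstanceAs (e.inverse.Linear k)⟩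

lemma LinearEquivalent.trans (h : LinearEquivalent k C D) (h' : LinearEquivalent k D E) :
    LinearEquivalent k C E := by
  obtain ⟨e, _, _⟩ := h
  obtain ⟨e', _, _⟩ := h'
  exact ⟨e.trans e', inferInstanceAs (e.functor ⋙ e'.functor).Additive,
    inferInstanceAs ((e.functor ⋙ e'.functor).Linear k)⟩

end LinearEquivalent

/-! ### Sheafification -/

section Sheafification

variable {k : Type u} [CommRing k] {C : Type u} [Category.{u} C] [Preadditive C] [Linear k C]
  {T : CoverSystem k C} (hT : T.IsTopology) {P : Cᵒᵖ ⥤ ModuleCat.{u} k} (hP : IsLinearPresheaf P)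
  (K : ∀ B : C, Submodule k (P.obj (op B)))

/-- Families of sections of `P` indexed by the morphisms to `A`. -/
abbrev SectionFamily (P : Cᵒᵖ ⥤ ModuleCat.{u} k) (A : C) : Type u :=
  ∀ B : C, (B ⟶ A) → P.obj (op B)

/-- The pullback of a family of sections. -/
def SectionFamily.pull (P : Cᵒᵖ ⥤ ModuleCat.{u} k) {A A' : C} (h : A' ⟶ A) :
    SectionFamily P A →ₗ[k] SectionFamily P A' where
  toFun x := fun B f => x B (f ≫ h)
  map_add' _ _ := rfl
  map_smul' _ _ := rfl

/-- On the sieve `R`, the family `x` is a morphism of presheaves `R ⟶ P / K`. -/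
structure IsGoodOn {A : C} (R : LinSieve k A) (x : SectionFamily P A) : Prop where
  add : ∀ {B : C} {f g : B ⟶ A}, f ∈ R.arrows B → g ∈ R.arrows B →
    x B (f + g) - (x B f + x B g) ∈ K B
  smul : ∀ {B : C} (r : k) {f : B ⟶ A}, f ∈ R.arrows B → x B (r • f) - r • x B f ∈ K B
  comp : ∀ {B B' : C} (g : B' ⟶ B) {f : B ⟶ A}, f ∈ R.arrows B →
    x B' (g ≫ f) - res P g (x B f) ∈ K B'

variable {K} in
lemma IsGoodOn.mono {A : C} {R S : LinSieve k A} (h : R ≤ S) {x : SectionFamily P A}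
    (hx : IsGoodOn K S x) : IsGoodOn K R x where
  add hf hg := hx.add (h _ hf) (h _ hg)
  smul r _ hf := hx.smul r (h _ hf)
  comp g _ hf := hx.comp g (h _ hf)

variable {K} in
lemma IsGoodOn.pull {A A' : C} {R : LinSieve k A} {x : SectionFamily P A} (hx : IsGoodOn K R x)
    (h : A' ⟶ A) : IsGoodOn K (R.pullback h) (SectionFamily.pull P h x) where
  add {B f g} hf hg := by
    change x B ((f + g) ≫ h) - (x B (f ≫ h) + x B (g ≫ h)) ∈ K B
    rw [Preadditive.add_comp]
    exact hx.add hf hg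
  smul {B} r f hf := by
    change x B ((r • f) ≫ h) - r • x B (f ≫ h) ∈ K B
    rw [Linear.smul_comp]
    exact hx.smul r hf
  comp {B B'} g f hf := by
    change x B' ((g ≫ f) ≫ h) - res P g (x B (f ≫ h)) ∈ K B'
    rw [Category.assoc]
    exact hx.comp g hf

/-- The families that are good on a covering sieve. -/
def germs (A : C) : Submodule k (SectionFamily P A) where
  carrier := {x | ∃ R ∈ T A, IsGoodOn K R x}
  zero_mem' := ⟨⊤, hT.identity A, by constructor <;> simp⟩
  add_mem' {x y} := by
    rintro ⟨R, hR, hx⟩ ⟨S, hS, hy⟩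
    have hx' : IsGoodOn K (R.inter S) x := hx.mono (inter_le_left R S)
    have hy' : IsGoodOn K (R.inter S) y := hy.mono (inter_le_right R S)
    refine ⟨_, hT.inter_mem hR hS, ⟨fun {B f g} hf hg => ?_, fun {B} r f hf => ?_,
      fun {B B'} g f hf => ?_⟩⟩
    · convert add_mem (hx'.add hf hg) (hy'.add hf hg) using 1
      simp only [Pi.add_apply]
      abel
    · convert add_mem (hx'.smul r hf) (hy'.smul r hf) using 1
      simp only [Pi.add_apply, smul_add]
      abel
    · convert add_mem (hx'.comp g hf) (hy'.comp g hf) using 1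
      simp only [Pi.add_apply, map_add]
      abel
  smul_mem' r x := by
    rintro ⟨R, hR, hx⟩
    refine ⟨R, hR, ⟨fun {B f g} hf hg => ?_, fun {B} r' f hf => ?_, fun {B B'} g f hf => ?_⟩⟩
    · convert Submodule.smul_mem _ r (hx.add hf hg) using 1
      simp only [Pi.smul_apply, smul_sub, smul_add]
    · convert Submodule.smul_mem _ r (hx.smul r' hf) using 1
      simp only [Pi.smul_apply, smul_sub, smul_comm r r']
    · convert Submodule.smul_mem _ r (hx.comp g hf) using 1
      simp only [Pi.smul_apply, smul_sub, map_smul]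

/-- The families with values in `K` on a covering sieve. -/
def nullGerms (A : C) : Submodule k (SectionFamily P A) where
  carrier := {x | ∃ R ∈ T A, ∀ (B : C) (f : B ⟶ A), f ∈ R.arrows B → x B f ∈ K B}
  zero_mem' := ⟨⊤, hT.identity A, fun _ _ _ => zero_mem _⟩
  add_mem' := by
    rintro x y ⟨R, hR, hx⟩ ⟨S, hS, hy⟩
    exact ⟨_, hT.inter_mem hR hS, fun B f hf => add_mem (hx B f hf.1) (hy B f hf.2)⟩
  smul_mem' := by
    rintro r x ⟨R, hR, hx⟩
    exact ⟨R, hR, fun B f hf => Submodule.smul_mem _ r (hx B f hf)⟩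

/-- Sections of the sheaf associated to `P / K`. -/
abbrev GermModule (A : C) : Type u := germs hT K A ⧸ (nullGerms hT K A).submoduleOf (germs hT K A)

/-- The class of a good family. -/
def germMk (A : C) : germs hT K A →ₗ[k] GermModule hT K A := Submodule.mkQ _

lemma germMk_surjective (A : C) : Function.Surjective (germMk hT K A) := Submodule.mkQ_surjective _

lemma germMk_eq_zero {A : C} {x : germs hT K A} :
    germMk hT K A x = 0 ↔ x.1 ∈ nullGerms hT K A :=
  Submodule.Quotient.mk_eq_zero _

lemma germMk_eq {A : C} {x y : germs hT K A} :
    germMk hT K A x = germMk hT K A y ↔ x.1 - y.1 ∈ nullGerms hT K A := by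
  rw [← sub_eq_zero, ← map_sub, germMk_eq_zero]
  rfl

/-- The pullback of good families. -/
def germs.pull {A A' : C} (h : A' ⟶ A) : germs hT K A →ₗ[k] germs hT K A' :=
  (SectionFamily.pull P h).restrict fun x hx => by
    obtain ⟨R, hR, hx⟩ := hx
    exact ⟨_, hT.pullback h hR, hx.pull h⟩

/-- The restriction maps of the sheaf associated to `P / K`. -/
def germMap {A A' : C} (h : A' ⟶ A) : GermModule hT K A →ₗ[k] GermModule hT K A' :=
  Submodule.mapQ _ _ (germs.pull hT K h) fun x hx => by
    obtain ⟨R, hR, hx⟩ := hx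
    exact ⟨_, hT.pullback h hR, fun B f hf => hx B (f ≫ h) hf⟩

lemma germMap_mk {A A' : C} (h : A' ⟶ A) (x : germs hT K A) :
    germMap hT K h (germMk hT K A x) = germMk hT K A' (germs.pull hT K h x) := rfl

/-- The sheaf associated to `P / K`. -/
def germSheaf : Cᵒᵖ ⥤ ModuleCat.{u} k where
  obj A := ModuleCat.of k (GermModule hT K A.unop)
  map h := ModuleCat.ofHom (germMap hT K h.unop)
  map_id A := ModuleCat.hom_ext <| LinearMap.ext fun s => by
    obtain ⟨x, rfl⟩ := germMk_surjective hT K _ s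
    refine congr_arg (germMk hT K A.unop) (Subtype.ext (funext fun B => funext fun f => ?_))
    exact congr_arg (x.1 B) (Category.comp_id f)
  map_comp {A A' A''} f g := ModuleCat.hom_ext <| LinearMap.ext fun s => by
    obtain ⟨x, rfl⟩ := germMk_surjective hT K _ s
    refine congr_arg (germMk hT K A''.unop) (Subtype.ext (funext fun B => funext fun h => ?_))
    exact congr_arg (x.1 B) (Category.assoc _ _ _).symm

lemma germMap_add {A A' : C} (f g : A' ⟶ A) (s : GermModule hT K A) :
    germMap hT K (f + g) s = germMap hT K f s + germMap hT K g s := by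
  obtain ⟨x, rfl⟩ := germMk_surjective hT K _ s
  rw [germMap_mk, germMap_mk, germMap_mk, ← map_add, germMk_eq]
  obtain ⟨R, hR, hx⟩ := x.2
  refine ⟨_, hT.inter_mem (hT.pullback f hR) (hT.pullback g hR), fun B h hh => ?_⟩
  change x.1 B (h ≫ (f + g)) - (x.1 B (h ≫ f) + x.1 B (h ≫ g)) ∈ K B
  rw [Preadditive.comp_add]
  exact hx.add hh.1 hh.2

lemma germMap_smul {A A' : C} (r : k) (f : A' ⟶ A) (s : GermModule hT K A) :
    germMap hT K (r • f) s = r • germMap hT K f s := by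
  obtain ⟨x, rfl⟩ := germMk_surjective hT K _ s
  rw [germMap_mk, germMap_mk, ← map_smul, germMk_eq]
  obtain ⟨R, hR, hx⟩ := x.2
  refine ⟨_, hT.pullback f hR, fun B h hh => ?_⟩
  change x.1 B (h ≫ (r • f)) - r • x.1 B (h ≫ f) ∈ K B
  rw [Linear.comp_smul]
  exact hx.smul r hh

lemma germSheaf_isLinearPresheaf : IsLinearPresheaf (germSheaf hT K) where
  res_add := germMap_add hT K
  res_smul := germMap_smul hT K

/-- The family of restrictions of a section. -/
def germs.ofSection (A : C) : P.obj (op A) →ₗ[k] germs hT K A where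
  toFun p := ⟨fun B f => res P f p, ⊤, hT.identity A, by
    constructor
    · intro B f g _ _
      rw [hP.res_add, sub_self]
      exact zero_mem _
    · intro B r f _
      rw [hP.res_smul, sub_self]
      exact zero_mem _
    · intro B B' g f _
      rw [res_comp, sub_self]
      exact zero_mem _⟩
  map_add' p q := Subtype.ext (funext fun _ => funext fun _ => map_add _ _ _)
  map_smul' r p := Subtype.ext (funext fun _ => funext fun _ => map_smul _ _ _)

/-- The canonical morphism from `P` to the sheaf associated to `P / K`. -/
def toGermSheaf : P ⟶ germSheaf hT K where
  app A := ModuleCat.ofHom (germMk hT K A.unop ∘ₗ germs.ofSection hT hP K A.unop)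
  naturality _ A' h := ModuleCat.hom_ext <| LinearMap.ext fun p =>
    congr_arg (germMk hT K A'.unop) <| Subtype.ext <| funext fun _ => funext fun f =>
      (res_comp P h.unop f p).symm

variable {K} (hK : ∀ {B B' : C} (g : B' ⟶ B) {p : P.obj (op B)}, p ∈ K B → res P g p ∈ K B')
  (hKT : ∀ {A : C} {p : P.obj (op A)} {R : LinSieve k A}, R ∈ T A →
    (∀ (B : C) (f : B ⟶ A), f ∈ R.arrows B → res P f p ∈ K B) → p ∈ K A)

include hK hKT in
-- Stability of `K` under restriction gives one direction; `hKT`, which says that `P / K` is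
-- separated, gives the other.
lemma germMk_ofSection_eq_zero {A : C} {p : P.obj (op A)} :
    germMk hT K A (germs.ofSection hT hP K A p) = 0 ↔ p ∈ K A := by
  rw [germMk_eq_zero]
  refine ⟨fun ⟨R, hR, h⟩ => hKT hR h, fun h => ⟨⊤, hT.identity A, fun B f _ => hK f h⟩⟩

lemma germMap_eq_ofSection {A B : C} {x : germs hT K A} {R : LinSieve k A}
    (hx : IsGoodOn K R x.1) {f : B ⟶ A} (hf : f ∈ R.arrows B) :
    germMap hT K f (germMk hT K A x) = germMk hT K B (germs.ofSection hT hP K B (x.1 B f)) := by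
  rw [germMap_mk, germMk_eq]
  exact ⟨⊤, hT.identity B, fun B' g _ => hx.comp g hf⟩

lemma exists_cover_ofSection {A : C} (s : GermModule hT K A) :
    ∃ R ∈ T A, ∀ (B : C) (f : B ⟶ A), f ∈ R.arrows B →
      ∃ p : P.obj (op B), germMk hT K B (germs.ofSection hT hP K B p) = germMap hT K f s := by
  obtain ⟨x, rfl⟩ := germMk_surjective hT K _ s
  obtain ⟨R, hR, hx⟩ := x.2
  exact ⟨R, hR, fun B f hf => ⟨_, (germMap_eq_ofSection hT hP hx hf).symm⟩⟩

include hP hK hKT in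
lemma germModule_eq_zero {A : C} {s : GermModule hT K A} {R : LinSieve k A} (hR : R ∈ T A)
    (h : ∀ (B : C) (f : B ⟶ A), f ∈ R.arrows B → germMap hT K f s = 0) : s = 0 := by
  obtain ⟨x, rfl⟩ := germMk_surjective hT K _ s
  obtain ⟨S, hS, hx⟩ := x.2
  rw [germMk_eq_zero]
  refine ⟨_, hT.inter_mem hR hS, fun B f hf => ?_⟩
  rw [← germMk_ofSection_eq_zero hT hP hK hKT, ← germMap_eq_ofSection hT hP hx hf.2]
  exact h B f hf.1

include hP hK hKT in
-- Since `P / K` is separated, one round of local families already gives a sheaf. A matching family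
-- of germs takes values in sections of `P` on a smaller cover, and there it is itself a germ.
lemma existsUnique_germ {A : C} {R : LinSieve k A} (hR : R ∈ T A)
    (y : ∀ B : C, R.arrows B →ₗ[k] GermModule hT K B)
    (hy : ∀ {B B' : C} (g : B' ⟶ B) (f : R.arrows B),
      y B' ⟨g ≫ f.1, R.comp_mem g f.2⟩ = germMap hT K g (y B f)) :
    ∃! s : GermModule hT K A, ∀ (B : C) (f : R.arrows B), germMap hT K f.1 s = y B f := by
  classical
  refine existsUnique_of_exists_of_unique ?_ fun s s' hs hs' => ?_
  swap
  · rw [← sub_eq_zero]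
    refine germModule_eq_zero hT hP hK hKT hR fun B f hf => ?_
    rw [map_sub, hs B ⟨f, hf⟩, hs' B ⟨f, hf⟩, sub_self]
  let η : ∀ B : C, P.obj (op B) →ₗ[k] GermModule hT K B :=
    fun B => germMk hT K B ∘ₗ germs.ofSection hT hP K B
  have hη : ∀ {B : C} {p : P.obj (op B)}, η B p = 0 ↔ p ∈ K B :=
    germMk_ofSection_eq_zero hT hP hK hKT
  have hηres : ∀ {B B' : C} (g : B' ⟶ B) (p : P.obj (op B)),
      η B' (res P g p) = germMap hT K g (η B p) := fun g p =>
    app_res (toGermSheaf hT hP K) g p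
  -- The arrows `f` of `R` at which the germ `y f` is represented by a section of `P`.
  let D : LinSieve k A :=
    { arrows := fun B => ((LinearMap.range (η B)).comap (y B)).map (R.arrows B).subtype
      comp_mem := by
        rintro B B' g _ ⟨f, ⟨p, hp⟩, rfl⟩
        exact ⟨⟨g ≫ f.1, R.comp_mem g f.2⟩, ⟨res P g p, by rw [hηres, hp, hy]⟩, rfl⟩ }
  have hDR : ∀ {B : C} {f : B ⟶ A}, f ∈ D.arrows B → f ∈ R.arrows B := by
    rintro B _ ⟨f, -, rfl⟩
    exact f.2
  have hD : D ∈ T A := hT.mem_of_le_closure hR fun B f hf => by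
    obtain ⟨R', hR', h⟩ := exists_cover_ofSection hT hP (y B ⟨f, hf⟩)
    refine hT.mem_of_le hR' fun B' g hg => ?_
    obtain ⟨p, hp⟩ := h B' g hg
    exact ⟨⟨g ≫ f, R.comp_mem g hf⟩, ⟨p, hp.trans (hy g ⟨f, hf⟩).symm⟩, rfl⟩
  have hDη : ∀ {B : C} {f : B ⟶ A} (hf : f ∈ D.arrows B), ∃ p, η B p = y B ⟨f, hDR hf⟩ := by
    rintro B _ ⟨f, ⟨p, hp⟩, rfl⟩
    exact ⟨p, hp⟩
  -- Arbitrary representatives suffice, as goodness is only required modulo `K`; the value 0 outside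
  -- `D` is irrelevant.
  let x : SectionFamily P A := fun B f => if hf : f ∈ D.arrows B then (hDη hf).choose else 0
  have hx : ∀ {B : C} {f : B ⟶ A} (hf : f ∈ D.arrows B), η B (x B f) = y B ⟨f, hDR hf⟩ := by
    intro B f hf
    simp only [x, dif_pos hf]
    exact (hDη hf).choose_spec
  have hgood : IsGoodOn K D x :=
    { add := fun {B f g} hf hg => by
        rw [← hη, map_sub, map_add, hx hf, hx hg, hx (add_mem hf hg), sub_eq_zero, ← map_add]
        rfl
      smul := fun {B} r f hf => by
        rw [← hη, map_sub, map_smul, hx hf, hx (Submodule.smul_mem _ r hf), sub_eq_zero,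
          ← map_smul]
        rfl
      comp := fun {B B'} g f hf => by
        rw [← hη, map_sub, hηres, hx hf, hx (D.comp_mem g hf), sub_eq_zero]
        exact hy g ⟨f, hDR hf⟩ }
  have hs : ∀ {B : C} {f : B ⟶ A} (hf : f ∈ D.arrows B),
      germMap hT K f (germMk hT K A ⟨x, D, hD, hgood⟩) = y B ⟨f, hDR hf⟩ := fun hf =>
    (germMap_eq_ofSection hT hP hgood hf).trans (hx hf)
  refine ⟨germMk hT K A ⟨x, D, hD, hgood⟩, fun B f => ?_⟩
  rw [← sub_eq_zero]
  refine germModule_eq_zero hT hP hK hKT (hT.pullback f.1 hD) fun B' g hg => ?_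
  rw [map_sub, ← hy, sub_eq_zero]
  exact (res_comp (germSheaf hT K) f.1 g _).symm.trans (hs hg)

include hT hP in
/-- Sheafification of a quotient presheaf: for a subpresheaf `K` of `P`, there is a morphism to a
sheaf that is locally surjective and whose kernel is the closure of `K`. -/
theorem exists_sheafification (K : ∀ B : C, Submodule k (P.obj (op B)))
    (hK : ∀ {B B' : C} (g : B' ⟶ B) {p : P.obj (op B)}, p ∈ K B → res P g p ∈ K B') :
    ∃ (S : Cᵒᵖ ⥤ ModuleCat.{u} k) (η : P ⟶ S), IsLinearSheaf T S ∧
      (∀ (A : C) (p : P.obj (op A)), (η.app (op A)).hom p = 0 ↔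
        ∃ R ∈ T A, ∀ (B : C) (f : B ⟶ A), f ∈ R.arrows B → res P f p ∈ K B) ∧
      ∀ (A : C) (s : S.obj (op A)), ∃ R ∈ T A, ∀ (B : C) (f : B ⟶ A), f ∈ R.arrows B →
        ∃ p : P.obj (op B), (η.app (op B)).hom p = res S f s := by
  -- The sections locally in `K`: replacing `K` by this closure makes the quotient separated, so
  -- that the germ construction applies.
  let K' : ∀ B : C, Submodule k (P.obj (op B)) := fun A =>
    { carrier := {p | ∃ R ∈ T A, ∀ (B : C) (f : B ⟶ A), f ∈ R.arrows B → res P f p ∈ K B}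
      zero_mem' := ⟨⊤, hT.identity A, fun B f _ => by rw [map_zero]; exact zero_mem _⟩
      add_mem' := by
        rintro p q ⟨R, hR, hp⟩ ⟨S, hS, hq⟩
        refine ⟨_, hT.inter_mem hR hS, fun B f hf => ?_⟩
        rw [map_add]
        exact add_mem (hp B f hf.1) (hq B f hf.2)
      smul_mem' := by
        rintro r p ⟨R, hR, hp⟩
        refine ⟨R, hR, fun B f hf => ?_⟩
        rw [map_smul]
        exact Submodule.smul_mem _ r (hp B f hf) }
  have h₁ : ∀ {B B' : C} (g : B' ⟶ B) {p : P.obj (op B)}, p ∈ K' B → res P g p ∈ K' B' := by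
    rintro B B' g p ⟨R, hR, hp⟩
    refine ⟨_, hT.pullback g hR, fun B'' f hf => ?_⟩
    rw [← res_comp]
    exact hp B'' (f ≫ g) hf
  have h₂ : ∀ {A : C} {p : P.obj (op A)} {R : LinSieve k A}, R ∈ T A →
      (∀ (B : C) (f : B ⟶ A), f ∈ R.arrows B → res P f p ∈ K' B) → p ∈ K' A := by
    intro A p R hR h
    let S : LinSieve k A :=
      { arrows := fun B => (K B).comap (hP.actₗ p B)
        comp_mem := fun g f hf => by
          change res P (g ≫ f) p ∈ K _
          rw [res_comp]
          exact hK g hf }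
    refine ⟨S, hT.glueing S hR fun B f hf => ?_, fun B f hf => hf⟩
    obtain ⟨R', hR', h'⟩ := h B f hf
    refine hT.mem_of_le hR' fun B' g hg => ?_
    change res P (g ≫ f) p ∈ K _
    rw [res_comp]
    exact h' B' g hg
  exact ⟨germSheaf hT K', toGermSheaf hT hP K',
    (germSheaf_isLinearPresheaf hT K').isLinearSheaf fun A R hR y hy =>
      existsUnique_germ hT hP h₁ h₂ hR y fun g f => hy _ _ g f,
    fun A p => germMk_ofSection_eq_zero hT hP h₁ h₂, fun A s => exists_cover_ofSection hT hP s⟩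

end Sheafification

/-! ### The site of a category of sheaves -/

section SheafCategory

variable {k : Type u} [CommRing k] {C : Type u} [Category.{u} C] [Preadditive C] [Linear k C]
  {T : CoverSystem k C}

/-- The components of a morphism of sheaves. -/
def shApp {X Y : Sh T} (α : X ⟶ Y) (B : C) : X.obj.obj (op B) →ₗ[k] Y.obj.obj (op B) :=
  (α.hom.app (op B)).hom

lemma shApp_res {X Y : Sh T} (α : X ⟶ Y) {A B : C} (f : B ⟶ A) (s : X.obj.obj (op A)) :
    shApp α B (res X.obj f s) = res Y.obj f (shApp α A s) := app_res α.hom f s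

lemma shApp_id (X : Sh T) {B : C} (s : X.obj.obj (op B)) : shApp (𝟙 X) B s = s := rfl

lemma shApp_comp {X Y Z : Sh T} (α : X ⟶ Y) (β : Y ⟶ Z) {B : C} (s : X.obj.obj (op B)) :
    shApp (α ≫ β) B s = shApp β B (shApp α B s) := rfl

lemma shApp_add {X Y : Sh T} (α β : X ⟶ Y) {B : C} (s : X.obj.obj (op B)) :
    shApp (α + β) B s = shApp α B s + shApp β B s := rfl

lemma shApp_smul {X Y : Sh T} (r : k) (α : X ⟶ Y) {B : C} (s : X.obj.obj (op B)) :
    shApp (r • α) B s = r • shApp α B s := rfl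

lemma shApp_zero {X Y : Sh T} {B : C} (s : X.obj.obj (op B)) :
    shApp (0 : X ⟶ Y) B s = 0 := rfl

lemma sh_hom_ext {X Y : Sh T} {α β : X ⟶ Y}
    (h : ∀ (B : C) (s : X.obj.obj (op B)), shApp α B s = shApp β B s) : α = β := by
  ext ⟨B⟩ s
  exact h B s

variable (hT : T.IsTopology)
include hT

/-- The sheaf associated to a representable module. -/
lemma exists_sheafified_representable (A : C) :
    ∃ (L : Sh T) (e : L.obj.obj (op A)),
      (∀ (B : C) (p : B ⟶ A), res L.obj p e = 0 → LinSieve.annihilator p ∈ T B) ∧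
      ∀ (B : C) (s : L.obj.obj (op B)), ∃ R ∈ T B, ∀ (B' : C) (f : B' ⟶ B), f ∈ R.arrows B' →
        ∃ p : B' ⟶ A, res L.obj p e = res L.obj f s := by
  let P := (linearYoneda k C).obj A
  have hP : IsLinearPresheaf P :=
    ⟨fun f g y => Preadditive.add_comp _ _ _ f g y, fun r f y => Linear.smul_comp _ _ _ r f y⟩
  -- The representable module is sheafified with `K = 0`; the universal section is the image of the
  -- identity.
  obtain ⟨S, η, hS, hker, hsurj⟩ := exists_sheafification hT hP (fun _ => ⊥) fun g p hp => by
    rw [(Submodule.mem_bot k).1 hp, map_zero]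
    exact zero_mem _
  have hη : ∀ {B : C} (p : B ⟶ A), (η.app (op B)).hom p = res S p ((η.app (op A)).hom (𝟙 A)) :=
    fun {B} p => (congr_arg (η.app (op B)).hom (Category.comp_id p).symm).trans
      (app_res η p (𝟙 A : A ⟶ A))
  refine ⟨⟨S, hS⟩, (η.app (op A)).hom (𝟙 A), fun B p hp => ?_, fun B s => ?_⟩
  · obtain ⟨R, hR, h⟩ := (hker B p).1 ((hη p).trans hp)
    exact hT.mem_of_le hR fun B' f hf => (Submodule.mem_bot k).1 (h B' f hf)
  · obtain ⟨R, hR, h⟩ := hsurj B s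
    refine ⟨R, hR, fun B' f hf => ?_⟩
    obtain ⟨p, hp⟩ := h B' f hf
    exact ⟨p, (hη p).symm.trans hp⟩

/-- The sheaf associated to the representable module `C(-, A)`. -/
def sheafRep (A : C) : Sh T := (exists_sheafified_representable hT A).choose

/-- The universal section of `sheafRep`. -/
def univSection (A : C) : (sheafRep hT A).obj.obj (op A) :=
  (exists_sheafified_representable hT A).choose_spec.choose

lemma annihilator_mem_of_res_univSection {A B : C} {p : B ⟶ A}
    (hp : res (sheafRep hT A).obj p (univSection hT A) = 0) : LinSieve.annihilator p ∈ T B :=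
  (exists_sheafified_representable hT A).choose_spec.choose_spec.1 B p hp

lemma exists_cover_res_univSection {A B : C} (s : (sheafRep hT A).obj.obj (op B)) :
    ∃ R ∈ T B, ∀ (B' : C) (f : B' ⟶ B), f ∈ R.arrows B' → ∃ p : B' ⟶ A,
      res (sheafRep hT A).obj p (univSection hT A) = res (sheafRep hT A).obj f s :=
  (exists_sheafified_representable hT A).choose_spec.choose_spec.2 B s

/-- Every section is locally a restriction of the universal one. -/
lemma sheafRep_hom_ext {A : C} {X : Sh T} {α β : sheafRep hT A ⟶ X}
    (h : shApp α A (univSection hT A) = shApp β A (univSection hT A)) : α = β := by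
  refine sh_hom_ext fun B s => ?_
  obtain ⟨R, hR, hs⟩ := exists_cover_res_univSection hT s
  refine X.property.ext_of_cover hT hR fun B' f hf => ?_
  obtain ⟨p, hp⟩ := hs B' f hf
  rw [← shApp_res, ← shApp_res, ← hp, shApp_res, shApp_res, h]

/-- A section `s` is locally `e p` for the universal section `e`, and its image is glued from the
sections `x p`. Independence of `p` holds because `e p = 0` forces `p` to be locally zero. -/
lemma exists_lift {A : C} {X : Sh T} (x : X.obj.obj (op A)) :
    ∃ α : sheafRep hT A ⟶ X, shApp α A (univSection hT A) = x := by
  have hL := (sheafRep hT A).property.isLinearPresheaf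
  have hX := X.property.isLinearPresheaf
  set e := univSection hT A
  have key : ∀ (B : C) (s : (sheafRep hT A).obj.obj (op B)), ∃ z : X.obj.obj (op B),
      ∀ (B' : C) (f : B' ⟶ B) (p : B' ⟶ A),
        res (sheafRep hT A).obj p e = res (sheafRep hT A).obj f s →
          res X.obj f z = res X.obj p x := by
    intro B s
    obtain ⟨R, hR, hs⟩ := exists_cover_res_univSection hT s
    refine Exists.imp (fun z hz => ?_) (X.property.glue hT (A := B) (fun B' =>
      (LinearMap.eqLocus (hL.actₗ e B' ∘ₗ LinearMap.fst k (B' ⟶ A) (B' ⟶ B))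
        (hL.actₗ s B' ∘ₗ LinearMap.snd k _ _)).map
        ((LinearMap.snd k _ _).prod (hX.actₗ x B' ∘ₗ LinearMap.fst k _ _)))
      (fun {B₁ B₂} g {f z} h => ?_) hR (fun B' f hf => ?_) (fun B' z hz => ?_))
    · exact fun B' f p h => hz B' f _ ⟨(p, f), h, rfl⟩
    · obtain ⟨⟨p, b⟩, h, hf⟩ := h
      obtain ⟨rfl, rfl⟩ := Prod.ext_iff.1 hf
      refine ⟨(g ≫ p, g ≫ b), ?_, Prod.ext rfl (res_comp X.obj p g x)⟩
      change res _ p e = res _ b s at h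
      change res _ (g ≫ p) e = res _ (g ≫ b) s
      rw [res_comp, h, res_comp]
    · obtain ⟨p, hp⟩ := hs B' f hf
      exact ⟨_, ⟨(p, f), hp, rfl⟩⟩
    · obtain ⟨⟨p, b⟩, h, hf⟩ := hz
      obtain ⟨hb, hp⟩ := Prod.ext_iff.1 hf
      change b = 0 at hb
      change res X.obj p x = z at hp
      change res _ p e = res _ b s at h
      rw [← hp]
      rw [hb, hL.res_zero] at h
      refine X.property.ext_of_cover hT (annihilator_mem_of_res_univSection hT h) fun B'' f hf => ?_
      rw [← res_comp, mem_annihilator.1 hf, hX.res_zero, map_zero]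
  choose z hz using key
  let α : (sheafRep hT A).obj ⟶ X.obj :=
    { app := fun B => ModuleCat.ofHom
        { toFun := z B.unop
          map_add' := fun s s' => by
            obtain ⟨R, hR, hs⟩ := exists_cover_res_univSection hT s
            obtain ⟨R', hR', hs'⟩ := exists_cover_res_univSection hT s'
            refine X.property.ext_of_cover hT (hT.inter_mem hR hR') fun B' f hf => ?_
            obtain ⟨p, hp⟩ := hs B' f hf.1
            obtain ⟨p', hp'⟩ := hs' B' f hf.2
            rw [map_add, hz _ s B' f p hp, hz _ s' B' f p' hp', hz _ _ B' f (p + p')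
              (by rw [hL.res_add, map_add, hp, hp']), hX.res_add]
          map_smul' := fun r s => by
            obtain ⟨R, hR, hs⟩ := exists_cover_res_univSection hT s
            refine X.property.ext_of_cover hT hR fun B' f hf => ?_
            obtain ⟨p, hp⟩ := hs B' f hf
            rw [RingHom.id_apply, map_smul, hz _ s B' f p hp, hz _ _ B' f (r • p)
              (by rw [hL.res_smul, map_smul, hp]), hX.res_smul] }
      naturality := fun B₁ B₂ b => ModuleCat.hom_ext <| LinearMap.ext fun s => by
        change z B₂.unop (res _ b.unop s) = res _ b.unop (z B₁.unop s)
        obtain ⟨R, hR, hs⟩ := exists_cover_res_univSection hT s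
        refine X.property.ext_of_cover hT (hT.pullback b.unop hR) fun B' f hf => ?_
        obtain ⟨p, hp⟩ := hs B' (f ≫ b.unop) hf
        rw [← res_comp, hz _ _ B' _ p hp, hz _ _ B' f p (by rw [hp, res_comp])] }
  refine ⟨ObjectProperty.homMk α, ?_⟩
  change z A e = x
  have := hz A e A (𝟙 A) (𝟙 A) rfl
  rwa [res_id, res_id] at this

/-- The morphism from `sheafRep` corresponding to a section. -/
def sheafLift {A : C} {X : Sh T} (x : X.obj.obj (op A)) : sheafRep hT A ⟶ X :=
  (exists_lift hT x).choose

lemma sheafLift_univSection {A : C} {X : Sh T} (x : X.obj.obj (op A)) :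
    shApp (sheafLift hT x) A (univSection hT A) = x :=
  (exists_lift hT x).choose_spec

/-- The sheafified Yoneda functor. -/
def sheafYoneda : C ⥤ Sh T where
  obj A := sheafRep hT A
  map {A B} f := sheafLift hT (res _ f (univSection hT B))
  map_id A := sheafRep_hom_ext hT (by rw [sheafLift_univSection, res_id, shApp_id])
  map_comp f g := sheafRep_hom_ext hT (by
    rw [sheafLift_univSection, shApp_comp, sheafLift_univSection, shApp_res,
      sheafLift_univSection, res_comp])

/-- The universal section of `sheafYoneda`. -/
def yonedaSection (A : C) : ((sheafYoneda hT).obj A).obj.obj (op A) := univSection hT A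

lemma annihilator_mem_of_res_yonedaSection {A B : C} {p : B ⟶ A}
    (hp : res ((sheafYoneda hT).obj A).obj p (yonedaSection hT A) = 0) :
    LinSieve.annihilator p ∈ T B :=
  annihilator_mem_of_res_univSection hT hp

lemma exists_cover_res_yonedaSection {A B : C} (s : ((sheafYoneda hT).obj A).obj.obj (op B)) :
    ∃ R ∈ T B, ∀ (B' : C) (f : B' ⟶ B), f ∈ R.arrows B' → ∃ p : B' ⟶ A,
      res ((sheafYoneda hT).obj A).obj p (yonedaSection hT A) =
        res ((sheafYoneda hT).obj A).obj f s :=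
  exists_cover_res_univSection hT s

lemma yoneda_hom_ext {A : C} {X : Sh T} {α β : (sheafYoneda hT).obj A ⟶ X}
    (h : shApp α A (yonedaSection hT A) = shApp β A (yonedaSection hT A)) : α = β :=
  sheafRep_hom_ext hT h

/-- The morphism corresponding to a section. -/
def yonedaLift {A : C} {X : Sh T} (x : X.obj.obj (op A)) : (sheafYoneda hT).obj A ⟶ X :=
  sheafLift hT x

lemma shApp_yonedaLift {A : C} {X : Sh T} (x : X.obj.obj (op A)) :
    shApp (yonedaLift hT x) A (yonedaSection hT A) = x :=
  sheafLift_univSection hT x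

lemma yonedaLift_shApp {A : C} {X : Sh T} (α : (sheafYoneda hT).obj A ⟶ X) :
    yonedaLift hT (shApp α A (yonedaSection hT A)) = α :=
  yoneda_hom_ext hT (shApp_yonedaLift hT _)

lemma shApp_sheafYoneda_map {A B : C} (f : A ⟶ B) :
    shApp ((sheafYoneda hT).map f) A (yonedaSection hT A) =
      res ((sheafYoneda hT).obj B).obj f (yonedaSection hT B) :=
  sheafLift_univSection hT _

lemma shApp_sheafYoneda_map_comp {A B : C} {X : Sh T} (f : A ⟶ B)
    (α : (sheafYoneda hT).obj B ⟶ X) :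
    shApp ((sheafYoneda hT).map f ≫ α) A (yonedaSection hT A) =
      res X.obj f (shApp α B (yonedaSection hT B)) := by
  rw [shApp_comp, shApp_sheafYoneda_map, shApp_res]

lemma yonedaLift_res {X : Sh T} {A B : C} (f : B ⟶ A) (s : X.obj.obj (op A)) :
    yonedaLift hT (res X.obj f s) = (sheafYoneda hT).map f ≫ yonedaLift hT s :=
  yoneda_hom_ext hT (by rw [shApp_sheafYoneda_map_comp, shApp_yonedaLift, shApp_yonedaLift])

lemma yonedaLift_comp {X Y : Sh T} {A : C} (s : X.obj.obj (op A)) (r : X ⟶ Y) :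
    yonedaLift hT s ≫ r = yonedaLift hT (shApp r A s) :=
  yoneda_hom_ext hT (by rw [shApp_comp, shApp_yonedaLift, shApp_yonedaLift])

variable (X : Sh T) in
/-- Sections of `X` correspond to morphisms to `X`. -/
def yonedaLiftₗ (A : C) : X.obj.obj (op A) →ₗ[k] ((sheafYoneda hT).obj A ⟶ X) where
  toFun := yonedaLift hT
  map_add' s t := yoneda_hom_ext hT (by simp only [shApp_yonedaLift, shApp_add])
  map_smul' r s := yoneda_hom_ext hT (by simp only [shApp_yonedaLift, shApp_smul, RingHom.id_apply])

instance : (sheafYoneda hT).Additive where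
  map_add {A B f g} := yoneda_hom_ext hT (by
    rw [shApp_add, shApp_sheafYoneda_map, shApp_sheafYoneda_map, shApp_sheafYoneda_map]
    exact ((sheafYoneda hT).obj B).property.isLinearPresheaf.res_add f g _)

instance : (sheafYoneda hT).Linear k where
  map_smul {A B} f r := yoneda_hom_ext hT (by
    rw [shApp_smul, shApp_sheafYoneda_map, shApp_sheafYoneda_map]
    exact ((sheafYoneda hT).obj B).property.isLinearPresheaf.res_smul r f _)

/-- Jointly epimorphic sieves in a category of sheaves are the sieves that are locally surjective
on sections. -/
lemma jointlyEpi_eq_coinduced :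
    CoverSystem.jointlyEpi k (Sh T) = T.coinduced (sheafYoneda hT) := by
  funext X
  have hX := X.property.isLinearPresheaf
  refine Set.Subset.antisymm (fun R hR A x => ?_) fun R hR D g hg => ?_
  · let K : ∀ B : C, Submodule k (X.obj.obj (op B)) :=
      fun B => (R.arrows ((sheafYoneda hT).obj B)).comap (yonedaLiftₗ hT X B)
    have hmem : ∀ {B : C} {s : X.obj.obj (op B)}, s ∈ K B ↔ yonedaLift hT s ∈ R.arrows _ := Iff.rfl
    have hK : ∀ {B B' : C} (g : B' ⟶ B) {s : X.obj.obj (op B)}, s ∈ K B →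
        res X.obj g s ∈ K B' := fun {B B'} g {s} hs => by
      rw [hmem, yonedaLift_res]
      exact R.comp_mem _ hs
    obtain ⟨S, η, hS, hker, -⟩ := exists_sheafification hT hX K hK
    let D : Sh T := ⟨S, hS⟩
    let g : X ⟶ D := ObjectProperty.homMk η
    have hg : g = 0 := hR D g fun Y r hr => sh_hom_ext fun B y => by
      rw [shApp_comp, shApp_zero]
      refine (hker B _).2 ⟨⊤, hT.identity B, fun B' f _ => hK f ?_⟩
      rw [hmem, ← yonedaLift_comp]
      exact R.comp_mem _ hr
    obtain ⟨R', hR', h⟩ := (hker A (shApp x A (yonedaSection hT A))).1 (by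
      change shApp g A _ = 0
      rw [hg, shApp_zero])
    refine hT.mem_of_le hR' fun B f hf => ?_
    have := h B f hf
    rwa [hmem, yonedaLift_res, yonedaLift_shApp] at this
  · refine sh_hom_ext fun B s => ?_
    -- Conversely, `s` lies in `R` on a cover, and there `g` kills it; `D` is separated.
    refine D.property.ext_of_cover hT (hR B (yonedaLift hT s)) fun B' f hf => ?_
    have h := hg _ _ ((mem_restrict _).1 hf)
    rw [Category.assoc, yonedaLift_comp] at h
    have h' := shApp_sheafYoneda_map_comp hT f (yonedaLift hT (shApp g B s))
    rw [h, shApp_zero, shApp_yonedaLift] at h'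
    rw [← h', shApp_zero, map_zero]

lemma jointlyEpi_isTopology : (CoverSystem.jointlyEpi k (Sh T)).IsTopology := by
  rw [jointlyEpi_eq_coinduced hT]
  exact CoverSystem.coinduced_isTopology _ hT

/-- The sheafified Yoneda functor satisfies (LC). -/
theorem satisfiesLC_sheafYoneda :
    SatisfiesLC T (sheafYoneda hT) (CoverSystem.jointlyEpi k (Sh T)) := by
  refine SatisfiesLC.of_sieves hT (fun X D g hg => sh_hom_ext fun B s => ?_) (fun X X' c => ?_)
    (fun X X' b hb => ?_) (fun X R hR D g hg => yoneda_hom_ext hT ?_)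
    fun X => (congr_fun (jointlyEpi_eq_coinduced hT) X).subset
  · have h := hg _ _ (mem_imageSieve (sheafYoneda hT) (yonedaLift hT s))
    rw [yonedaLift_comp] at h
    rw [← shApp_yonedaLift hT (shApp g B s), h, shApp_zero, shApp_zero]
  · obtain ⟨R, hR, h⟩ := exists_cover_res_yonedaSection hT (shApp c X (yonedaSection hT X))
    refine hT.mem_of_le hR fun B f hf => ?_
    obtain ⟨p, hp⟩ := h B f hf
    refine (mem_liftSieve _).2 ⟨p, yoneda_hom_ext hT ?_⟩
    rw [shApp_sheafYoneda_map_comp, ← hp, shApp_sheafYoneda_map]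
  · refine annihilator_mem_of_res_yonedaSection hT ?_
    rw [← shApp_sheafYoneda_map, hb, shApp_zero]
  · refine D.property.ext_of_cover hT hR fun B f hf => ?_
    rw [shApp_zero, map_zero, ← shApp_sheafYoneda_map_comp, hg _ _ (mem_map (sheafYoneda hT) hf),
      shApp_zero]

/-- The site `(C, T)` as a site for the category `Sh(C, T)`. -/
def lcMorphismSheaf : LCMorphism.{u} k (Sh T) where
  site := C
  top := T
  isTopology := hT
  functor := sheafYoneda hT
  additive_functor := inferInstance
  linear_functor := inferInstance
  satisfiesLC := satisfiesLC_sheafYoneda hT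

end SheafCategory

/-! ### Tensor products of categories of sheaves -/

section Main

variable {k : Type u} [CommRing k]
  {A : Type u} [Category.{u} A] [Preadditive A] [Linear k A] {TA : CoverSystem k A}
  {B : Type u} [Category.{u} B] [Preadditive B] [Linear k B] {TB : CoverSystem k B}

/-- The large site on the left does not depend on `U` and `V`, so it serves as the common term of
comparison. The comparison theorem requires only the source of the (LC) functor to be small. -/
lemma LCMorphism.linearEquivalent_tensor
    {C : Type w₁} [Category.{u} C] [Preadditive C] [Linear k C]
    {D : Type w₂} [Category.{u} D] [Preadditive D] [Linear k D]
    (hC : (CoverSystem.jointlyEpi k C).IsTopology) (hD : (CoverSystem.jointlyEpi k D).IsTopology)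
    (U : LCMorphism.{u} k C) (V : LCMorphism.{u} k D) :
    LinearEquivalent k
      (Sh (tensorTopology (CoverSystem.jointlyEpi k C) (CoverSystem.jointlyEpi k D)))
      (Sh (tensorTopology U.top V.top)) := by
  have := U.additive_functor
  have := U.linear_functor
  have := V.additive_functor
  have := V.linear_functor
  exact (U.satisfiesLC.tensor U.isTopology V.isTopology hC hD V.satisfiesLC).linearEquivalent
    (tensorTopology_isTopology _ _) (tensorTopology_isTopology _ _)

/-- The category of sheaves on the tensor product of two sites is the tensor product of the
categories of sheaves. -/
theorem isGrothendieckTensor_sh (hTA : TA.IsTopology) (hTB : TB.IsTopology) :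
    IsGrothendieckTensor k (Sh TA) (Sh TB) (Sh (tensorTopology TA TB)) where
  nonempty_left := ⟨lcMorphismSheaf hTA⟩
  nonempty_right := ⟨lcMorphismSheaf hTB⟩
  equivalent U V := by
    have hA := jointlyEpi_isTopology hTA
    have hB := jointlyEpi_isTopology hTB
    exact (LCMorphism.linearEquivalent_tensor hA hB (lcMorphismSheaf hTA)
      (lcMorphismSheaf hTB)).symm.trans (LCMorphism.linearEquivalent_tensor hA hB U V)

end Main

end

/-! ### The main theorem -/

theorem mainTheorem3 {k : Type u} [CommRing k] (a b : ZAlgebra.{u} k)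
    (ha : a.GeneratedInDegrees {1}) (hb : b.GeneratedInDegrees {1}) :
    SatisfiesLC (a.diagonal b).tailsTopology (a.diagonalFunctor b)
        (tensorTopology a.tailsTopology b.tailsTopology) ∧
    (a.diagonal b).tailsTopology =
      (tensorTopology a.tailsTopology b.tailsTopology).inverseImage (a.diagonalFunctor b) ∧
    IsGrothendieckTensor k (Sh a.tailsTopology) (Sh b.tailsTopology)
      (Sh (tensorTopology a.tailsTopology b.tailsTopology)) ∧
    LinearEquivalent k (Sh (tensorTopology a.tailsTopology b.tailsTopology))
      (Sh (a.diagonal b).tailsTopology) ∧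
    IsGrothendieckTensor k (Sh a.tailsTopology) (Sh b.tailsTopology)
      (Sh (a.diagonal b).tailsTopology) := by
  have hLC := ZAlgebra.satisfiesLC_diagonalFunctor ha hb
  have htensor := isGrothendieckTensor_sh a.tailsTopology_isTopology b.tailsTopology_isTopology
  have hequiv := hLC.linearEquivalent (a.diagonal b).tailsTopology_isTopology
    (tensorTopology_isTopology _ _)
  -- The tensor product is defined up to linear equivalence, so the last claim is transported along
  -- `hequiv`.
  exact ⟨hLC, hLC.topology_eq, htensor, hequiv, htensor.nonempty_left, htensor.nonempty_right,
    fun U V => hequiv.symm.trans (htensor.equivalent U V)⟩
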